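/- **Theorem.** Let $k$ be a field of characteristic zero and $n\ge 2$. Let $D_n$ be the Coxeter group of type $D$, that is, the group of permutations of $\{-n,\dots,-1,1,\dots,n\}$ generated by $S=\{s_{1'},s_1,\dots,s_{n-1}\}$, where $s_i=(-i-1,\,-i)(i,\,i+1)$ and $s_{1'}=(-2,1)(-1,2)$. For $J\subseteq S$ let $W_J$ be the subgroup generated by $J$, let $X_J$ be the set of minimal length representatives (length with respect to $S$) of the left cosets $wW_J$, and let $\mathcal X_J=\sum_{w\in X_J}w\in k[D_n]$. The descent algebra $\Sigma_{D_n}$ over $k$ is the subalgebra of $k[D_n]$ generated by the elements $\mathcal X_J$, $J\subseteq S$ (by a theorem of Solomon it is also their linear span). Let $\mathcal C(n)$ be the disjoint union of the sets $\mathcal C_{<n}$ of compositions of integers $m$ with $0\le m\le n-2$; $\mathcal C_1$ of compositions of $n$ with first component $1$; $\mathcal C_n$ of compositions of $n$ with first component at least $2$; and a second copy $\mathcal C_n'$ of $\mathcal C_n$. To $\kappa=[\kappa_1,\dots,\kappa_r]\in\mathcal C(n)$ associate the following subset $J(\kappa)$ of $S$: - $\{s_{\kappa_0},s_{\kappa_0+\kappa_1},\dots,s_{\kappa_0+\cdots+\kappa_{r-1}}\}$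 with $\kappa_0=n-m$, if $\kappa\in\mathcal C_{<n}$ is a composition of $m$ (the empty set if $m=0$); - $\{s_{1'},s_{\kappa_1},s_{\kappa_1+\kappa_2},\dots,s_{\kappa_1+\cdots+\kappa_{r-1}}\}$, if $\kappa\in\mathcal C_1$ or $\kappa\in\mathcal C_n$; - $\{s_1,s_{\kappa_1},s_{\kappa_1+\kappa_2},\dots,s_{\kappa_1+\cdots+\kappa_{r-1}}\}$, if $\kappa\in\mathcal C_n'$. Put $B_\kappa=\mathcal X_{S\setminus J(\kappa)}$. For $\kappa,\nu\in\mathcal C(n)$ write $\kappa\approx\nu$ if the components of $\kappa$ can be re-ordered to give the components of $\nu$, except that $\kappa\not\approx\nu$ when one of $\kappa,\nu$ lies in $\mathcal C_n$, the other lies in $\mathcal C_n'$, and all components are even. Then the (Jacobson) radical of $\Sigma_{D_n}$ is the $k$-linear span of all differences $B_\kappa-B_\nu$ with $\kappa,\nu\in\mathcal C(n)$ and $\kappa\approx\nu$. -/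

import Mathlib

/-! ### Descent algebras -/

/-- The length of `w` with respect to `S`: the least number of factors in an expression of `w`
as a product of elements of `S`. (It is only used for generating sets `S` of involutions, so
that every `w` has such an expression.) -/
noncomputable def wordLength {W : Type*} [Group W] (S : Set W) (w : W) : ℕ :=
  sInf {r : ℕ | ∃ l : List W, (∀ x ∈ l, x ∈ S) ∧ l.length = r ∧ l.prod = w}

/-- `X_J`: the elements `w` that have minimal length in their left coset `w W_J`, where `W_J` is
the subgroup generated by `J`. -/
def minCosetReps {W : Type*} [Group W] (S J : Set W) : Set W :=
  {w : W | ∀ u ∈ Subgroup.closure J, wordLength S w ≤ wordLength S (w * u)}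

/-- The formal sum of the elements of `X_J`, in the group algebra `k[W]`. -/
noncomputable def cosetSum (k : Type*) [Field k] {W : Type*} [Group W] [Finite W]
    (S J : Set W) : MonoidAlgebra k W :=
  ∑ w ∈ (Set.toFinite (minCosetReps S J)).toFinset, MonoidAlgebra.of k W w

/-- The descent algebra of `(W, S)` over `k`: the subalgebra of the group algebra generated by the
sums of `X_J`, for `J ⊆ S`. For a finite Coxeter group the linear span of these sums is closed
under multiplication, by a theorem of Solomon, so this subalgebra is that span. -/
noncomputable def descentAlgebra (k : Type*) [Field k] {W : Type*} [Group W] [Finite W]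
    (S : Set W) : Subalgebra k (MonoidAlgebra k W) :=
  Algebra.adjoin k {x | ∃ J : Set W, J ⊆ S ∧ x = cosetSum k S J}

/-- The sum of the elements of `X_J` as an element of the descent algebra. -/
noncomputable def descentElt (k : Type*) [Field k] {W : Type*} [Group W] [Finite W]
    (S J : Set W) (hJ : J ⊆ S) : descentAlgebra k S :=
  ⟨cosetSum k S J, Algebra.subset_adjoin ⟨J, hJ, rfl⟩⟩

/-! ### The Coxeter group of type `D` -/

/-- The set `{-n, …, -1, 1, …, n}`. -/
abbrev SignedPoint (n : ℕ) : Type := {i : ℤ // i ≠ 0 ∧ -(n : ℤ) ≤ i ∧ i ≤ (n : ℤ)}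

instance SignedPoint.instFinite (n : ℕ) : Finite (SignedPoint n) :=
  Set.Finite.to_subtype
    ((Set.finite_Icc (-(n : ℤ)) (n : ℤ)).subset fun _ h => ⟨h.2.1, h.2.2⟩)

/-- The permutation `s_{1'} = (-2, 1)(-1, 2)`. -/
def permOnePrime (n : ℕ) [hn : n.AtLeastTwo] : Equiv.Perm (SignedPoint n) :=
  Equiv.swap ⟨-2, by have := hn.prop; omega⟩ ⟨1, by have := hn.prop; omega⟩ *
    Equiv.swap ⟨-1, by have := hn.prop; omega⟩ ⟨2, by have := hn.prop; omega⟩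

/-- The permutation `s_i = (-i-1, -i)(i, i+1)`, for `1 ≤ i ≤ n - 1`. -/
def permS (n i : ℕ) (h₁ : 1 ≤ i) (h₂ : i < n) : Equiv.Perm (SignedPoint n) :=
  Equiv.swap ⟨-(i : ℤ) - 1, by omega⟩ ⟨-(i : ℤ), by omega⟩ *
    Equiv.swap ⟨(i : ℤ), by omega⟩ ⟨(i : ℤ) + 1, by omega⟩

/-- The `n` generators, indexed by `Fin n`: the index `0` stands for the label `1'`, and the index
`i` with `1 ≤ i ≤ n - 1` for the label `i`. -/
def permGen (n : ℕ) [n.AtLeastTwo] (i : Fin n) : Equiv.Perm (SignedPoint n) :=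
  if h : (i : ℕ) = 0 then permOnePrime n else permS n i (Nat.one_le_iff_ne_zero.mpr h) i.isLt

/-- The Coxeter group `D_n`, as the group of permutations of `{-n, …, -1, 1, …, n}` generated by
`s_{1'}, s_1, …, s_{n-1}`. -/
abbrev DGroup (n : ℕ) [n.AtLeastTwo] : Subgroup (Equiv.Perm (SignedPoint n)) :=
  Subgroup.closure (Set.range (permGen n))

/-- The generators as elements of `D_n`. -/
def gen (n : ℕ) [n.AtLeastTwo] (i : Fin n) : DGroup n :=
  ⟨permGen n i, Subgroup.subset_closure (Set.mem_range_self i)⟩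

/-- The generating set `S` of `D_n`. -/
def genSet (n : ℕ) [n.AtLeastTwo] : Set (DGroup n) := Set.range (gen n)

/-- The descent algebra of `D_n` over `k`. -/
noncomputable abbrev SigmaD (k : Type*) [Field k] (n : ℕ) [n.AtLeastTwo] :
    Subalgebra k (MonoidAlgebra k (DGroup n)) :=
  descentAlgebra k (genSet n)

/-! ### The compositions that label subsets of `S` -/

/-- The labels `C(n)`, the disjoint union of
* `C_{<n}`: the compositions of some `m ≤ n - 2`,
* `C_1`: the compositions of `n` with first component `1`,
* `C_n`: the compositions of `n` with first component at least `2`,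
* `C_n'`: a second copy of `C_n`. -/
inductive DComp (n : ℕ) : Type
  | below (m : ℕ) (hm : m + 2 ≤ n) (c : Composition m) : DComp n
  | one (c : Composition n) (hc : c.blocks.head? = some 1) : DComp n
  | full (c : Composition n) (hc : ∃ a, 2 ≤ a ∧ c.blocks.head? = some a) : DComp n
  | fullPrime (c : Composition n) (hc : ∃ a, 2 ≤ a ∧ c.blocks.head? = some a) : DComp n

namespace DComp

/-- The list of components. -/
def components {n : ℕ} : DComp n → List ℕ
  | below _ _ c => c.blocks
  | one c _ => c.blocks
  | full c _ => c.blocks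
  | fullPrime c _ => c.blocks

/-- Membership in `C_n`. -/
def InFull {n : ℕ} : DComp n → Prop
  | full _ _ => True
  | _ => False

/-- Membership in `C_n'`. -/
def InFullPrime {n : ℕ} : DComp n → Prop
  | fullPrime _ _ => True
  | _ => False

/-- The indices (in the convention of `permGen`, where `0` stands for `1'`) of the generators in
the subset corresponding to a label. Here `c.sizeUpTo j` is the sum of the first `j`
components. -/
def indexSet {n : ℕ} : DComp n → Set (Fin n)
  | below m _ c => {i | ∃ j < c.length, (i : ℕ) = (n - m) + c.sizeUpTo j}
  | one c _ => {i | (i : ℕ) = 0 ∨ ∃ j, 1 ≤ j ∧ j < c.length ∧ (i : ℕ) = c.sizeUpTo j}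
  | full c _ => {i | (i : ℕ) = 0 ∨ ∃ j, 1 ≤ j ∧ j < c.length ∧ (i : ℕ) = c.sizeUpTo j}
  | fullPrime c _ => {i | (i : ℕ) = 1 ∨ ∃ j, 1 ≤ j ∧ j < c.length ∧ (i : ℕ) = c.sizeUpTo j}

/-- The subset `J` of `S` corresponding to a label. -/
def subsetOf {n : ℕ} [n.AtLeastTwo] (κ : DComp n) : Set (DGroup n) :=
  gen n '' κ.indexSet

/-- The relation `κ ≈ ν`: the components agree up to order, except that an element of `C_n` and
an element of `C_n'` are not related if all components are even. -/
def Equivalent {n : ℕ} (κ ν : DComp n) : Prop :=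
  κ.components.Perm ν.components ∧
    ¬ (κ.InFull ∧ ν.InFullPrime ∧ ∀ a ∈ κ.components, Even a) ∧
    ¬ (κ.InFullPrime ∧ ν.InFull ∧ ∀ a ∈ κ.components, Even a)

end DComp

/-- `B_κ`: the sum of `X_{S \ J}`, where `J ⊆ S` corresponds to `κ`. -/
noncomputable def basisB (k : Type*) [Field k] {n : ℕ} [n.AtLeastTwo] (κ : DComp n) :
    SigmaD k n :=
  descentElt k (genSet n) (genSet n \ κ.subsetOf) Set.sdiff_subset

/-! ### Signed points, simple roots, and inversions -/

/-! Odd integer vectors are read as points of the reflection arrangement of type D. Its faces form a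
semigroup: `FG` is the face entered on leaving `F` a little in the direction of `G`, and `faceMul`
realises this on integral vectors. Let `C` be the fundamental chamber. Replacing each face `F` of an
orbit by the group element `w` with `FC = wC` and summing gives `𝒳_J` up to the order of a
stabilizer (`orbitSum_of_dominant`). A product of two orbit sums is again a sum of orbit sums
(`orbitSum_mul_orbitSum`); this yields Solomon's theorem together with explicit structure constants.

In the product of the orbit sums of `E` and `F` the terms come from the faces `F(gE)`. Either every
root vanishing on `F` vanishes on `gE`, and then `F(gE) = F`, or strictly fewer roots vanish on
`F(gE)` than on `F`. Hence left multiplication is triangular for the number of vanishing roots, and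
its diagonal coefficients count the `g` of the first kind (`orbitSum_mul_sub_mem`, `fixCount`).

In an algebra with such a basis the radical is the common kernel of the diagonal coefficients
(`mem_jacobson_iff_diagCoeff`). Here these coefficients depend on the left factor only through the
conjugacy class of its set of vanishing roots. As a matrix over the classes they are triangular,
with diagonal entries that are nonzero in characteristic zero. So the common kernel is spanned by
the differences of basis elements in one class (`jacobson_eq_span_sub`).

It remains to match these classes with `≈` (`DComp.zeroConj_iff`). The vector `DComp.vec` of a label
is constant on consecutive blocks whose sizes are the components. Conjugacy preserves block sizes.
Conversely, equal block sizes give a signed permutation between the two vectors' zero sets, and only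
the parity of its number of sign changes matters. A block of odd size can be used to correct the
parity; when all blocks are even and no coordinate is zero, the parity separates `C_n` from `C_n'`.
-/

namespace SignedPoint

variable {n : ℕ}

instance instNeg : Neg (SignedPoint n) := ⟨fun p => ⟨-p.1, by have := p.2; omega⟩⟩

noncomputable instance instFintype : Fintype (SignedPoint n) := Fintype.ofFinite _

@[simp] theorem val_neg (p : SignedPoint n) : (-p).1 = -p.1 := rfl

instance instInvolutiveNeg : InvolutiveNeg (SignedPoint n) where
  neg_neg p := Subtype.ext (by simp)

end SignedPoint

open SignedPoint

/-- A pair `(p, q)` stands for the root `v ↦ v q - v p`; it is positive if `p < q`. The pairs with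
`q = -p` do not give roots of type `D`. -/
def PosPair {n : ℕ} (p q : SignedPoint n) : Prop := p < q ∧ q ≠ -p

theorem PosPair.neg {n : ℕ} {p q : SignedPoint n} (h : PosPair p q) : PosPair (-q) (-p) := by
  obtain ⟨h1, h2⟩ := h
  refine ⟨?_, ?_⟩
  · rw [← Subtype.coe_lt_coe] at h1 ⊢
    simp only [val_neg]
    omega
  · rintro h
    apply h2
    rw [neg_neg] at h
    exact h.symm

/-- Odd functions on the signed points, which stand for vectors of `ℤ ^ n`. -/
def OddVec {n : ℕ} (v : SignedPoint n → ℤ) : Prop := ∀ p, v (-p) = - v p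

/-- The vector `(1, …, n)`. -/
def rho (n : ℕ) (p : SignedPoint n) : ℤ := p.1

theorem oddVec_rho (n : ℕ) : OddVec (rho n) := fun _ => rfl

theorem rho_lt_rho {n : ℕ} {p q : SignedPoint n} : rho n p < rho n q ↔ p < q := Iff.rfl

set_option linter.unusedSectionVars false

section
variable {n : ℕ} [hn : n.AtLeastTwo]

/-- The smaller point of the pair of a simple root. -/
def rootLo (i : Fin n) : SignedPoint n :=
  ⟨if (i : ℕ) = 0 then -1 else (i : ℤ), by have := hn.prop; split_ifs <;> omega⟩

/-- The larger point of the pair of a simple root. -/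
def rootHi (i : Fin n) : SignedPoint n :=
  ⟨if (i : ℕ) = 0 then 2 else (i : ℤ) + 1, by have := hn.prop; split_ifs <;> omega⟩

theorem posPair_root (i : Fin n) : PosPair (rootLo i) (rootHi i) := by
  refine ⟨?_, ?_⟩
  · rw [← Subtype.coe_lt_coe]
    simp only [rootLo, rootHi]
    split_ifs <;> omega
  · intro h
    have h1 := congrArg Subtype.val h
    simp only [rootLo, rootHi, val_neg] at h1
    split_ifs at h1 <;> omega

/-- Using the pair `(-1, 2)` for the index `0` puts `s_{1'}` and the `s_i` under one formula, so
that later arguments need not separate them. -/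
theorem gen_apply (i : Fin n) (p : SignedPoint n) :
    (gen n i).1 p = if p = rootLo i then rootHi i else if p = rootHi i then rootLo i else
      if p = -rootLo i then -rootHi i else if p = -rootHi i then -rootLo i else p := by
  have := hn.prop
  apply Subtype.ext
  by_cases h : (i : ℕ) = 0
  · simp only [gen, permGen, h, dif_pos, permOnePrime, Equiv.Perm.mul_apply, Equiv.swap_apply_def,
      Subtype.ext_iff, rootLo, rootHi, val_neg, if_true, apply_ite Subtype.val]
    split_ifs <;> first | omega | contradiction
  · simp only [gen, permGen, h, dif_neg, permS, Equiv.Perm.mul_apply, Equiv.swap_apply_def,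
      Subtype.ext_iff, rootLo, rootHi, val_neg, if_false, not_false_eq_true,
      apply_ite Subtype.val]
    split_ifs <;> omega

theorem gen_apply_neg (i : Fin n) (p : SignedPoint n) : (gen n i).1 (-p) = -(gen n i).1 p := by
  have hp := p.2
  apply Subtype.ext
  simp only [gen_apply, Subtype.ext_iff, rootLo, rootHi, val_neg, apply_ite Subtype.val]
  split_ifs <;> omega

@[simp] theorem gen_apply_lo (i : Fin n) : (gen n i).1 (rootLo i) = rootHi i := by
  simp [gen_apply]

@[simp] theorem gen_apply_hi (i : Fin n) : (gen n i).1 (rootHi i) = rootLo i := by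
  have := (posPair_root i).1.ne'
  simp [gen_apply, this]

theorem gen_apply_gen (i : Fin n) (p : SignedPoint n) : (gen n i).1 ((gen n i).1 p) = p := by
  have hp := p.2
  apply Subtype.ext
  simp only [gen_apply, Subtype.ext_iff, rootLo, rootHi, val_neg, apply_ite Subtype.val]
  split_ifs <;> first | omega | contradiction

theorem gen_mul_gen (i : Fin n) : gen n i * gen n i = 1 :=
  Subtype.ext (Equiv.ext fun p => gen_apply_gen i p)

theorem gen_injective : Function.Injective (gen n) := by
  intro i j h
  have h1 : (gen n i).1 (rootLo j) = rootHi j := by rw [h, gen_apply_lo]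
  have h2 := congrArg Subtype.val h1
  simp only [gen_apply, Subtype.ext_iff, rootLo, rootHi, val_neg, apply_ite Subtype.val] at h2
  apply Fin.ext
  have := i.2
  have := j.2
  split_ifs at h2 <;> first | omega | contradiction

/-- A simple reflection permutes the positive roots other than its own; the last two alternatives
are the two pairs that represent its own root. -/
theorem PosPair.gen_apply {p q : SignedPoint n} (h : PosPair p q) (i : Fin n) :
    PosPair ((gen n i).1 p) ((gen n i).1 q) ∨ (p = rootLo i ∧ q = rootHi i) ∨
      (p = -rootHi i ∧ q = -rootLo i) := by
  obtain ⟨h1, h2⟩ := h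
  have hp := p.2
  have hq := q.2
  rw [Ne, Subtype.ext_iff] at h2
  rw [← Subtype.coe_lt_coe] at h1
  simp only [PosPair, ← Subtype.coe_lt_coe, Ne, _root_.gen_apply, Subtype.ext_iff, rootLo, rootHi,
    val_neg, apply_ite Subtype.val] at h1 h2 ⊢
  split_ifs <;> omega

theorem coe_apply_neg (g : DGroup n) (p : SignedPoint n) : g.1 (-p) = -g.1 p := by
  obtain ⟨g, hg⟩ := g
  induction hg using Subgroup.closure_induction generalizing p with
  | mem x hx => obtain ⟨i, rfl⟩ := hx; exact gen_apply_neg i p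
  | one => rfl
  | mul x y hx hy ihx ihy =>
    have h1 := ihy p
    have h2 := ihx (y p)
    simp only [Equiv.Perm.mul_apply] at *
    rw [h1, h2]
  | inv x hx ih =>
    have h1 := ih (x⁻¹ p)
    simp only [Equiv.Perm.coe_inv, Equiv.apply_symm_apply] at *
    rw [← h1, Equiv.symm_apply_apply]

/-! ### The action on vectors, chambers and inversions. -/

/-- The action of the group on vectors, by pullback. -/
def pull (v : SignedPoint n → ℤ) (g : DGroup n) : SignedPoint n → ℤ := fun p => v (g.1 p)

theorem pull_apply (v : SignedPoint n → ℤ) (g : DGroup n) (p : SignedPoint n) :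
    pull v g p = v (g.1 p) := rfl

theorem pull_pull (v : SignedPoint n → ℤ) (g h : DGroup n) :
    pull (pull v g) h = pull v (g * h) := rfl

@[simp] theorem pull_one (v : SignedPoint n → ℤ) : pull v 1 = v := rfl

theorem OddVec.pull {v : SignedPoint n → ℤ} (hv : OddVec v) (g : DGroup n) :
    OddVec (pull v g) := fun p => by
  rw [pull_apply, coe_apply_neg, hv, pull_apply]

theorem pull_gen_eq_self {v : SignedPoint n → ℤ} (hv : OddVec v) {i : Fin n}
    (h : v (rootLo i) = v (rootHi i)) : pull v (gen n i) = v := by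
  funext p
  rw [pull_apply, gen_apply]
  split_ifs with h1 h2 h3 h4
  · rw [h1, h]
  · rw [h2, h]
  · rw [h3, hv, hv, h]
  · rw [h4, hv, hv, h]
  · rfl

theorem ne_neg_pull_iff (g : DGroup n) (p q : SignedPoint n) : g.1 q ≠ -g.1 p ↔ q ≠ -p := by
  rw [← coe_apply_neg, Ne, Ne, g.1.injective.eq_iff]

/-- The vector lies in the closed fundamental chamber. -/
def Dominant (v : SignedPoint n → ℤ) : Prop := ∀ p q, PosPair p q → v p ≤ v q

/-- The vector lies in the open fundamental chamber. -/
def StrictDominant (v : SignedPoint n → ℤ) : Prop := ∀ p q, PosPair p q → v p < v q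

/-- Positive roots are nonnegative combinations of simple ones. Concretely, the indices `i ≥ 1` make
`v` increase along `1, …, n`, and the index `0` handles the roots that are sums of two coordinates.
-/
theorem dominant_of_simple {v : SignedPoint n → ℤ} (hv : OddVec v)
    (h : ∀ i, v (rootLo i) ≤ v (rootHi i)) : Dominant v := by
  have h2n := hn.prop
  have mono : ∀ (b a : ℕ) (ha : 1 ≤ a) (hab : a ≤ b) (hb : b ≤ n),
      v ⟨a, by omega⟩ ≤ v ⟨b, by omega⟩ := by
    intro b a ha hab hb
    induction b, hab using Nat.le_induction with
    | base => exact le_rfl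
    | succ b hab ih =>
      refine (ih (by omega)).trans ?_
      have := h ⟨b, by omega⟩
      simp only [rootLo, rootHi] at this
      rw [show (⟨(b : ℤ), by omega⟩ : SignedPoint n) =
        ⟨if b = 0 then -1 else (b : ℤ), by split_ifs <;> omega⟩ from
          Subtype.ext (by simp only; split_ifs <;> omega)]
      refine this.trans_eq (congrArg v (Subtype.ext ?_))
      simp only
      split_ifs <;> push_cast <;> omega
  -- This is the inequality for the index `0`, with `v (-1)` rewritten as `-v 1`.
  have h0 : 0 ≤ v ⟨1, by omega⟩ + v ⟨2, by omega⟩ := by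
    have h1 := h ⟨0, by omega⟩
    have h2 := hv ⟨1, by omega⟩
    simp only [rootLo, rootHi, if_true] at h1
    have h3 : (-(⟨1, by omega⟩ : SignedPoint n)) = ⟨-1, by omega⟩ := rfl
    rw [h3] at h2
    linarith
  have sum : ∀ (a b : ℕ) (ha : 1 ≤ a) (hab : a < b) (hb : b ≤ n),
      0 ≤ v ⟨a, by omega⟩ + v ⟨b, by omega⟩ := by
    intro a b ha hab hb
    have h1 := mono a 1 le_rfl ha (by omega)
    have h2 := mono b 2 (by omega) (by omega) hb
    simp only [Nat.cast_one, Nat.cast_ofNat] at h1 h2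
    linarith
  intro p q hpq
  obtain ⟨⟨x, hx⟩, ⟨y, hy⟩⟩ := p, q
  obtain ⟨h1, h2⟩ := hpq
  rw [← Subtype.coe_lt_coe] at h1
  rw [Ne, Subtype.ext_iff] at h2
  simp only [val_neg] at h1 h2
  rcases lt_or_gt_of_ne hx.1 with hx0 | hx0
  · obtain ⟨a, rfl⟩ : ∃ a : ℕ, x = -(a : ℤ) := ⟨x.natAbs, by omega⟩
    have e1 : v ⟨-(a : ℤ), hx⟩ = - v ⟨a, by omega⟩ := hv ⟨a, by omega⟩
    rw [e1]
    rcases lt_or_gt_of_ne hy.1 with hy0 | hy0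
    · obtain ⟨b, rfl⟩ : ∃ b : ℕ, y = -(b : ℤ) := ⟨y.natAbs, by omega⟩
      have e2 : v ⟨-(b : ℤ), hy⟩ = - v ⟨b, by omega⟩ := hv ⟨b, by omega⟩
      rw [e2]
      have := mono a b (by omega) (by omega) (by omega)
      linarith
    · obtain ⟨b, rfl⟩ : ∃ b : ℕ, y = (b : ℤ) := ⟨y.natAbs, by omega⟩
      rcases lt_or_gt_of_ne (show a ≠ b by omega) with hab | hab
      · have := sum a b (by omega) hab (by omega)
        linarith
      · have := sum b a (by omega) hab (by omega)
        linarith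
  · obtain ⟨a, rfl⟩ : ∃ a : ℕ, x = (a : ℤ) := ⟨x.natAbs, by omega⟩
    obtain ⟨b, rfl⟩ : ∃ b : ℕ, y = (b : ℤ) := ⟨y.natAbs, by omega⟩
    exact mono b a (by omega) (by omega) (by omega)

theorem strictDominant_of_simple {v : SignedPoint n → ℤ} (hv : OddVec v)
    (h : ∀ i, v (rootLo i) < v (rootHi i)) : StrictDominant v := by
  -- `rho` grows by at most 3 along a simple root (exactly 3 for the index `0`), while `v` grows by
  -- at least 1. So the weak criterion applies to `3v - rho`, and strictness returns because `rho`
  -- grows along every positive root.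
  have key : Dominant (fun p => 3 * v p - rho n p) := by
    refine dominant_of_simple (fun p => ?_) fun i => ?_
    · simp only [hv p, oddVec_rho n p]
      ring
    · have h1 := h i
      have : rho n (rootHi i) ≤ rho n (rootLo i) + 3 := by
        simp only [rho, rootLo, rootHi]
        split_ifs <;> omega
      linarith
  intro p q hpq
  have h1 := key p q hpq
  have h2 := rho_lt_rho.2 hpq.1
  simp only at h1
  linarith

theorem exists_gen_desc {v : SignedPoint n → ℤ} (hv : OddVec v) (h : ¬ Dominant v) :
    ∃ i, v (rootHi i) < v (rootLo i) := by
  by_contra! hc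
  exact h (dominant_of_simple hv hc)

open Classical in
/-- The pairs that are inverted by a vector. -/
noncomputable def invSet (v : SignedPoint n → ℤ) : Finset (SignedPoint n × SignedPoint n) :=
  Finset.univ.filter fun x => PosPair x.1 x.2 ∧ v x.2 < v x.1

theorem mem_invSet {v : SignedPoint n → ℤ} {x : SignedPoint n × SignedPoint n} :
    x ∈ invSet v ↔ PosPair x.1 x.2 ∧ v x.2 < v x.1 := by
  simp [invSet]

theorem invSet_eq_empty_iff {v : SignedPoint n → ℤ} : invSet v = ∅ ↔ Dominant v := by
  simp only [Finset.eq_empty_iff_forall_notMem, mem_invSet, Prod.forall, not_and, not_lt]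
  rfl

theorem rootPairs_card (i : Fin n) :
    ({(rootLo i, rootHi i), (-rootHi i, -rootLo i)} :
      Finset (SignedPoint n × SignedPoint n)).card = 2 := by
  rw [Finset.card_pair]
  intro h
  have h1 := congrArg Subtype.val (congrArg Prod.fst h)
  simp only [rootLo, rootHi, val_neg] at h1
  split_ifs at h1 <;> omega

/-- The reflection sends the inverted pairs not belonging to its own root to inverted pairs of `v`,
so at most the two pairs of that root are new. -/
theorem card_invSet_pull_gen_le {v : SignedPoint n → ℤ} (i : Fin n) :
    (invSet (pull v (gen n i))).card ≤ (invSet v).card + 2 := by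
  classical
  rw [← rootPairs_card i, ← Nat.sub_le_iff_le_add]
  refine (Finset.le_card_sdiff _ _).trans ?_
  refine Finset.card_le_card_of_injOn
    (fun x => ((gen n i).1 x.1, (gen n i).1 x.2)) ?_ ?_
  · rintro ⟨p, q⟩ hx
    simp only [Finset.coe_sdiff, Set.mem_sdiff, Finset.mem_coe, mem_invSet, pull_apply,
      Finset.mem_insert, Finset.mem_singleton, Prod.mk.injEq, not_or] at hx ⊢
    obtain ⟨⟨h1, h2⟩, h3⟩ := hx
    refine ⟨?_, h2⟩
    rcases h1.gen_apply i with h | h | h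
    · exact h
    · exact absurd h h3.1
    · exact absurd h h3.2
  · rintro ⟨p, q⟩ - ⟨p', q'⟩ - h
    simpa using h

/-- At a descent the two pairs of the simple root are inverted by `v` and no longer after the
reflection; the other inverted pairs are carried back injectively. This decrease drives the
inductions on inversions below. -/
theorem card_invSet_pull_gen_add_two {v : SignedPoint n → ℤ} (hv : OddVec v) {i : Fin n}
    (h : v (rootHi i) < v (rootLo i)) :
    (invSet (pull v (gen n i))).card + 2 ≤ (invSet v).card := by
  classical
  have hsub : ({(rootLo i, rootHi i), (-rootHi i, -rootLo i)} :
      Finset (SignedPoint n × SignedPoint n)) ⊆ invSet v := by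
    intro x hx
    simp only [Finset.mem_insert, Finset.mem_singleton] at hx
    rcases hx with rfl | rfl
    · exact mem_invSet.2 ⟨posPair_root i, h⟩
    · refine mem_invSet.2 ⟨(posPair_root i).neg, ?_⟩
      simp only [hv _]
      linarith
  rw [← Nat.le_sub_iff_add_le (by rw [← rootPairs_card i]; exact Finset.card_le_card hsub),
    ← rootPairs_card i, ← Finset.card_sdiff_of_subset hsub]
  refine Finset.card_le_card_of_injOn
    (fun x => ((gen n i).1 x.1, (gen n i).1 x.2)) ?_ ?_
  · rintro ⟨p, q⟩ hx
    simp only [Finset.mem_coe, mem_invSet, pull_apply] at hx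
    obtain ⟨h1, h2⟩ := hx
    simp only [Finset.coe_sdiff, Set.mem_sdiff, Finset.mem_coe, mem_invSet,
      Finset.mem_insert, Finset.mem_singleton, Prod.mk.injEq, not_or]
    rcases h1.gen_apply i with h' | h' | h'
    · refine ⟨⟨h', h2⟩, ?_, ?_⟩
      · rintro ⟨e1, e2⟩
        have e3 : p = rootHi i := by rw [← gen_apply_gen i p, e1, gen_apply_lo]
        have e4 : q = rootLo i := by rw [← gen_apply_gen i q, e2, gen_apply_hi]
        subst e3 e4
        exact absurd h1.1 (posPair_root i).1.not_gt
      · rintro ⟨e1, e2⟩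
        have e3 : p = -rootLo i := by
          rw [← gen_apply_gen i p, e1, gen_apply_neg, gen_apply_hi]
        have e4 : q = -rootHi i := by
          rw [← gen_apply_gen i q, e2, gen_apply_neg, gen_apply_lo]
        subst e3 e4
        exact absurd h1.1 (posPair_root i).neg.1.not_gt
    · obtain ⟨rfl, rfl⟩ := h'
      rw [gen_apply_lo, gen_apply_hi] at h2
      exact absurd h h2.not_gt
    · obtain ⟨rfl, rfl⟩ := h'
      rw [gen_apply_neg, gen_apply_neg, gen_apply_lo, gen_apply_hi, hv, hv] at h2
      exact absurd h (by linarith)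
  · rintro ⟨p, q⟩ - ⟨p', q'⟩ - h
    simpa using h

/-- Every vector is moved into the closed fundamental chamber by some group element. -/
theorem exists_dominant_pull {v : SignedPoint n → ℤ} (hv : OddVec v) :
    ∃ g : DGroup n, Dominant (pull v g) := by
  induction h : (invSet v).card using Nat.strong_induction_on generalizing v with
  | _ N ih =>
    by_cases hd : Dominant v
    · exact ⟨1, hd⟩
    · obtain ⟨i, hi⟩ := exists_gen_desc hv hd
      have := card_invSet_pull_gen_add_two hv hi
      obtain ⟨g, hg⟩ := ih _ (by omega) (hv.pull (gen n i)) rfl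
      exact ⟨gen n i * g, hg⟩

end

/-! ### Parity of signed permutations -/

section
variable {n : ℕ}

/-- The absolute value of a signed point. -/
def absPt (p : SignedPoint n) : SignedPoint n := if 0 < p.1 then p else -p

theorem absPt_pos (p : SignedPoint n) : 0 < (absPt p).1 := by
  have := p.2
  unfold absPt
  split_ifs with h
  · exact h
  · simp only [val_neg]; omega

theorem absPt_of_pos {p : SignedPoint n} (h : 0 < p.1) : absPt p = p := if_pos h

theorem absPt_eq_or (p : SignedPoint n) : absPt p = p ∨ absPt p = -p := by
  unfold absPt
  split_ifs <;> simp

theorem absPt_neg (p : SignedPoint n) : absPt (-p) = absPt p := by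
  have := p.2
  unfold absPt
  simp only [val_neg, neg_neg]
  split_ifs <;> first | rfl | omega

theorem absPt_apply_absPt {g : SignedPoint n → SignedPoint n} (hg : ∀ p, g (-p) = -g p)
    (p : SignedPoint n) : absPt (g (absPt p)) = absPt (g p) := by
  rcases absPt_eq_or p with h | h <;> rw [h]
  rw [hg, absPt_neg]

/-- The points `1, …, n`. -/
noncomputable def posPts (n : ℕ) : Finset (SignedPoint n) :=
  Finset.univ.filter fun p => 0 < p.1

theorem mem_posPts {p : SignedPoint n} : p ∈ posPts n ↔ 0 < p.1 := by simp [posPts]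

/-- The product of the signs of the coordinates of a vector. -/
noncomputable def signProd (v : SignedPoint n → ℤ) : ℤ := ∏ p ∈ posPts n, (v p).sign

theorem prod_absPt_apply {M : Type*} [CommMonoid M] {g : Equiv.Perm (SignedPoint n)}
    (hg : ∀ p, g (-p) = -g p) (f : SignedPoint n → M) :
    ∏ p ∈ posPts n, f (absPt (g p)) = ∏ p ∈ posPts n, f p := by
  have hg' : ∀ p, g.symm (-p) = -g.symm p := fun p => by
    rw [Equiv.symm_apply_eq, hg, Equiv.apply_symm_apply]
  refine Finset.prod_nbij' (fun p => absPt (g p)) (fun p => absPt (g.symm p)) ?_ ?_ ?_ ?_ ?_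
  · exact fun p _ => mem_posPts.2 (absPt_pos _)
  · exact fun p _ => mem_posPts.2 (absPt_pos _)
  · intro p hp
    rw [absPt_apply_absPt hg', Equiv.symm_apply_apply, absPt_of_pos (mem_posPts.1 hp)]
  · intro p hp
    rw [absPt_apply_absPt hg, Equiv.apply_symm_apply, absPt_of_pos (mem_posPts.1 hp)]
  · exact fun p _ => rfl

/-- By oddness the sign of `v` at `g p` is the sign of `g p` times the sign of `v` at `|g p|`, and
`p ↦ |g p|` permutes the positive points. -/
theorem signProd_comp {g : Equiv.Perm (SignedPoint n)} (hg : ∀ p, g (-p) = -g p)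
    {v : SignedPoint n → ℤ} (hv : OddVec v) :
    signProd (fun p => v (g p)) = signProd (fun p => (g p).1) * signProd v := by
  unfold signProd
  rw [← prod_absPt_apply hg fun p => (v p).sign, ← Finset.prod_mul_distrib]
  refine Finset.prod_congr rfl fun p _ => ?_
  have := (g p).2
  unfold absPt
  split_ifs with h
  · rw [Int.sign_eq_one_of_pos h, one_mul]
  · rw [Int.sign_eq_neg_one_of_neg (by omega : (g p).1 < 0), hv, Int.sign_neg]
    ring

theorem signProd_rho (n : ℕ) : signProd (rho n) = 1 :=
  Finset.prod_eq_one fun _ hp => Int.sign_eq_one_of_pos (mem_posPts.1 hp)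

variable [hn : n.AtLeastTwo]

theorem signProd_gen (i : Fin n) : signProd (fun p => ((gen n i).1 p).1) = 1 := by
  have h2 := hn.prop
  unfold signProd
  -- Only `s_{1'}` changes signs, and it changes exactly two of them: `1 ↦ -2` and `2 ↦ -1`.
  have key : ∀ p ∈ posPts n, ((gen n i).1 p).1.sign =
      if (i : ℕ) = 0 ∧ (p.1 = 1 ∨ p.1 = 2) then -1 else 1 := by
    intro p hp
    rw [mem_posPts] at hp
    by_cases h : (i : ℕ) = 0 ∧ (p.1 = 1 ∨ p.1 = 2)
    · rw [if_pos h, Int.sign_eq_neg_one_iff_neg]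
      obtain ⟨h0, h1⟩ := h
      simp only [gen_apply, Subtype.ext_iff, rootLo, rootHi, val_neg, apply_ite Subtype.val, h0,
        if_true]
      split_ifs <;> omega
    · rw [if_neg h, Int.sign_eq_one_iff_pos]
      simp only [gen_apply, Subtype.ext_iff, rootLo, rootHi, val_neg, apply_ite Subtype.val]
      split_ifs <;> omega
  rw [Finset.prod_congr rfl key]
  by_cases h0 : (i : ℕ) = 0
  · rw [Finset.prod_eq_mul (⟨1, by omega⟩ : SignedPoint n) ⟨2, by omega⟩]
    · simp [h0]
    · simp [Subtype.ext_iff]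
    · rintro ⟨c, hc'⟩ - hc
      simp only [ne_eq, Subtype.mk.injEq] at hc
      simp [h0, hc]
    · intro h; exact absurd (mem_posPts.2 (by simp)) h
    · intro h; exact absurd (mem_posPts.2 (by simp)) h
  · simp [h0]

theorem signProd_pull (g : DGroup n) {v : SignedPoint n → ℤ} (hv : OddVec v) :
    signProd (pull v g) = signProd v := by
  obtain ⟨g, hg⟩ := g
  induction hg using Subgroup.closure_induction generalizing v with
  | mem x hx =>
    obtain ⟨i, rfl⟩ := hx
    have := signProd_comp (fun p => gen_apply_neg i p) hv
    rw [signProd_gen, one_mul] at this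
    exact this
  | one => rfl
  | mul x y hx hy ihx ihy =>
    rw [← ihx hv, ← ihy (hv.pull ⟨x, hx⟩)]
    rfl
  | inv x hx ih =>
    rw [← ih (hv.pull ⟨x⁻¹, inv_mem hx⟩), pull_pull]
    congr 1
    funext p
    simp [pull_apply]

/-! ### The group acts simply transitively on the chambers -/

/-- Strict dominance says `|g i| < g j` for `0 < i < j`. So the absolute values form an increasing
permutation of `1, …, n`, hence the identity, and every image except perhaps that of `1` is
positive. The sign product decides this last sign. -/
theorem perm_eq_one_of_strictDominant {g : Equiv.Perm (SignedPoint n)}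
    (hg : ∀ p, g (-p) = -g p) (hd : StrictDominant fun p => (g p).1)
    (hs : signProd (fun p => (g p).1) = 1) : g = 1 := by
  have h2 := hn.prop
  let pt : Fin n → SignedPoint n := fun i => ⟨(i : ℤ) + 1, by omega⟩
  have hlt : ∀ i j, i < j → (g (pt i)).1 < (g (pt j)).1 ∧ -(g (pt i)).1 < (g (pt j)).1 := by
    intro i j hij
    have hij' : (i : ℕ) < j := hij
    refine ⟨hd _ _ ⟨?_, ?_⟩, ?_⟩
    · rw [← Subtype.coe_lt_coe]; simp only [pt]; omega
    · rw [Ne, Subtype.ext_iff]; simp only [pt, val_neg]; omega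
    · have := hd (-pt i) (pt j) ⟨?_, ?_⟩
      · simpa only [hg, val_neg] using this
      · rw [← Subtype.coe_lt_coe]; simp only [pt, val_neg]; omega
      · rw [Ne, Subtype.ext_iff]; simp only [pt, val_neg]; omega
  let h : Fin n → Fin n := fun i => ⟨(g (pt i)).1.natAbs - 1, by have := (g (pt i)).2; omega⟩
  have hh : StrictMono h := by
    intro i j hij
    have h1 := hlt i j hij
    have h3 := (g (pt i)).2
    have h4 := (g (pt j)).2
    rw [Fin.lt_def]
    simp only [h]
    omega
  have hid : h = id := by
    refine (hh.range_inj strictMono_id).1 ?_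
    rw [Set.range_id, (Finite.injective_iff_surjective.1 hh.injective).range_eq]
  have habs : ∀ i, (g (pt i)).1.natAbs = i + 1 := by
    intro i
    have h1 := congrArg Fin.val (congrFun hid i)
    have h3 := (g (pt i)).2
    simp only [h, id] at h1
    omega
  have hpos1 : ∀ i : Fin n, 0 < (i : ℕ) → 0 < (g (pt i)).1 := by
    intro i hi
    have := hlt ⟨0, by omega⟩ i hi
    omega
  have hpos0 : 0 < (g (pt ⟨0, by omega⟩)).1 := by
    unfold signProd at hs
    rw [Finset.prod_eq_single (pt ⟨0, by omega⟩)] at hs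
    · exact Int.sign_eq_one_iff_pos.1 hs
    · intro p hp hp1
      rw [mem_posPts] at hp
      have hp2 := p.2
      rw [Ne, Subtype.ext_iff] at hp1
      simp only [pt] at hp1
      have := hpos1 ⟨p.1.toNat - 1, by omega⟩ (by simp; omega)
      convert Int.sign_eq_one_of_pos this using 5
      apply Subtype.ext
      simp only [pt]
      omega
    · intro h; exact absurd (mem_posPts.2 (by simp [pt])) h
  have hfix : ∀ p : SignedPoint n, 0 < p.1 → g p = p := by
    intro p hp
    have hp2 := p.2
    obtain ⟨i, rfl⟩ : ∃ i, p = pt i :=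
      ⟨⟨p.1.toNat - 1, by omega⟩, Subtype.ext (by simp only [pt]; omega)⟩
    have h1 := habs i
    apply Subtype.ext
    have : 0 < (g (pt i)).1 := by
      rcases Nat.eq_zero_or_pos (i : ℕ) with h0 | h0
      · rwa [show i = ⟨0, by omega⟩ from Fin.ext h0]
      · exact hpos1 i h0
    simp only [pt] at *
    omega
  ext p
  rcases absPt_eq_or p with h1 | h1
  · rw [← h1, hfix _ (absPt_pos p)]; rfl
  · have := hfix _ (absPt_pos p)
    rw [h1, hg, neg_inj] at this
    rw [this]; rfl

theorem eq_one_of_strictDominant {g : DGroup n} (hd : StrictDominant (pull (rho n) g)) :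
    g = 1 := by
  refine Subtype.ext (perm_eq_one_of_strictDominant (coe_apply_neg g) hd ?_)
  exact (signProd_pull g (oddVec_rho n)).trans (signProd_rho n)

theorem strictDominant_pull_rho_of_dominant {g : Equiv.Perm (SignedPoint n)}
    (h : Dominant fun p => (g p).1) : StrictDominant fun p => (g p).1 := fun p q hpq =>
  lt_of_le_of_ne (h p q hpq) fun e => hpq.1.ne (g.injective (Subtype.ext e))

theorem eq_one_of_dominant {g : DGroup n} (hd : Dominant (pull (rho n) g)) : g = 1 :=
  eq_one_of_strictDominant (strictDominant_pull_rho_of_dominant hd)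

/-- The group consists of the signed permutations with an even number of sign changes. -/
theorem mem_DGroup_of_signProd {g : Equiv.Perm (SignedPoint n)} (hg : ∀ p, g (-p) = -g p)
    (hs : signProd (fun p => (g p).1) = 1) : g ∈ DGroup n := by
  have hodd : OddVec (fun p => (g p).1) := fun p => by
    simp only [hg, val_neg]
  obtain ⟨w, hw⟩ := exists_dominant_pull hodd
  -- After `g` has been moved into the fundamental chamber by an element `w` of the group, nothing
  -- but the identity is left, so `g` is the inverse of `w`.
  have h1 : g * w.1 = 1 := by
    refine perm_eq_one_of_strictDominant (fun p => ?_)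
      (strictDominant_pull_rho_of_dominant hw) ?_
    · rw [Equiv.Perm.mul_apply, coe_apply_neg, hg, Equiv.Perm.mul_apply]
    · exact (signProd_pull w hodd).trans hs
  rw [eq_inv_of_mul_eq_one_left h1]
  exact inv_mem w.2

/-- A group element that maps a vector of the open chamber to one is the identity. -/
theorem eq_one_of_strictDominant_pull {v : SignedPoint n → ℤ} {g : DGroup n}
    (hv : StrictDominant v) (hg : StrictDominant (pull v g)) : g = 1 := by
  apply eq_one_of_dominant
  intro p q hpq
  by_contra! h
  have h1 : PosPair (g.1 q) (g.1 p) := by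
    refine ⟨h, ?_⟩
    rw [ne_neg_pull_iff]
    rintro rfl
    exact hpq.2 (neg_neg q).symm
  exact (hv _ _ h1).not_gt (hg _ _ hpq)

/-! ### Length, and minimal coset representatives -/

/-- Splitting off a descent on the right lowers the number of inverted pairs by at least 2, until
the identity is reached. -/
theorem exists_list_gen (g : DGroup n) : ∃ l : List (DGroup n), (∀ x ∈ l, x ∈ genSet n) ∧
    l.prod = g ∧ 2 * l.length ≤ (invSet (pull (rho n) g)).card := by
  induction h : (invSet (pull (rho n) g)).card using Nat.strong_induction_on generalizing g with
  | _ N ih =>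
    by_cases hd : Dominant (pull (rho n) g)
    · exact ⟨[], by simp, (eq_one_of_dominant hd).symm, by simp⟩
    · obtain ⟨i, hi⟩ := exists_gen_desc ((oddVec_rho n).pull g) hd
      have h1 := card_invSet_pull_gen_add_two ((oddVec_rho n).pull g) hi
      rw [pull_pull] at h1
      obtain ⟨l, hl1, hl2, hl3⟩ := ih _ (by omega) (g * gen n i) rfl
      refine ⟨l ++ [gen n i], ?_, ?_, ?_⟩
      · intro x hx
        rcases List.mem_append.1 hx with hx | hx
        · exact hl1 x hx
        · rw [List.mem_singleton.1 hx]; exact ⟨i, rfl⟩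
      · rw [List.prod_append, hl2, List.prod_singleton, mul_assoc, gen_mul_gen, mul_one]
      · simp only [List.length_append, List.length_singleton]
        omega

theorem card_invSet_prod_le (l : List (DGroup n)) (hl : ∀ x ∈ l, x ∈ genSet n) :
    (invSet (pull (rho n) l.prod)).card ≤ 2 * l.length := by
  induction l using List.reverseRecOn with
  | nil =>
    have : Dominant (pull (rho n) 1) := fun p q hpq => (rho_lt_rho.2 hpq.1).le
    rw [List.prod_nil, invSet_eq_empty_iff.2 this]
    simp
  | append_singleton l x ih =>
    obtain ⟨i, rfl⟩ := hl x (by simp)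
    have h1 := ih fun x hx => hl x (by simp [hx])
    have h2 := card_invSet_pull_gen_le (v := pull (rho n) l.prod) i
    rw [List.prod_append, List.prod_singleton, ← pull_pull]
    simp only [List.length_append, List.length_singleton]
    omega

/-- The length is half the number of inverted pairs, as each positive root comes from two
pairs. -/
theorem two_mul_wordLength (g : DGroup n) :
    2 * wordLength (genSet n) g = (invSet (pull (rho n) g)).card := by
  obtain ⟨l, hl1, hl2, hl3⟩ := exists_list_gen g
  apply le_antisymm
  · refine le_trans ?_ hl3
    exact Nat.mul_le_mul_left 2 (Nat.sInf_le ⟨l, hl1, rfl, hl2⟩)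
  · obtain ⟨l', h1, h2, h3⟩ := Nat.sInf_mem
      (s := {r : ℕ | ∃ l : List (DGroup n), (∀ x ∈ l, x ∈ genSet n) ∧ l.length = r ∧ l.prod = g})
      ⟨_, l, hl1, rfl, hl2⟩
    have := card_invSet_prod_le l' h1
    rw [h3, h2] at this
    exact this

theorem wordLength_le_iff (g h : DGroup n) : wordLength (genSet n) g ≤ wordLength (genSet n) h ↔
    (invSet (pull (rho n) g)).card ≤ (invSet (pull (rho n) h)).card := by
  rw [← two_mul_wordLength, ← two_mul_wordLength]
  omega

end

/-! ### Faces and their product -/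

section
variable {n : ℕ}

/-- A vector close to `v` in the direction of `u`: it represents the product, in the face
semigroup, of the faces of `v` and of `u`. -/
noncomputable def faceMul (v u : SignedPoint n → ℤ) : SignedPoint n → ℤ :=
  fun p => (1 + 2 * ∑ q, |u q|) * v p + u p

theorem OddVec.faceMul {v u : SignedPoint n → ℤ} (hv : OddVec v) (hu : OddVec u) :
    OddVec (faceMul v u) := fun p => by
  simp only [_root_.faceMul, hv p, hu p]
  ring

/-- Distinct values of `v` differ by at least 1, and the factor `1 + 2 ∑ |u|` exceeds every
difference of two values of `u`. So `faceMul v u` orders points lexicographically, by `v` and then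
by `u`. -/
theorem faceMul_lt_of_lt {v : SignedPoint n → ℤ} (u : SignedPoint n → ℤ) {p q : SignedPoint n}
    (h : v p < v q) : faceMul v u p < faceMul v u q := by
  have hp := Finset.single_le_sum (f := fun q => |u q|) (fun q _ => abs_nonneg (u q))
    (Finset.mem_univ p)
  have hq := Finset.single_le_sum (f := fun q => |u q|) (fun q _ => abs_nonneg (u q))
    (Finset.mem_univ q)
  have h1 := le_abs_self (u p)
  have h2 := neg_abs_le (u q)
  simp only [faceMul] at *
  have h3 : v p + 1 ≤ v q := h
  have h4 : 0 ≤ (1 + 2 * ∑ q, |u q|) := by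
    have := (abs_nonneg (u p)).trans hp
    linarith
  have := mul_le_mul_of_nonneg_left h3 h4
  linarith

theorem faceMul_lt_faceMul {v u : SignedPoint n → ℤ} {p q : SignedPoint n} :
    faceMul v u p < faceMul v u q ↔ v p < v q ∨ (v p = v q ∧ u p < u q) := by
  rcases lt_trichotomy (v p) (v q) with h | h | h
  · simp [h, faceMul_lt_of_lt u h]
  · simp [faceMul, h]
  · simp [h.not_gt, h.ne', (faceMul_lt_of_lt u h).le]

theorem faceMul_eq_faceMul {v u : SignedPoint n → ℤ} {p q : SignedPoint n} :
    faceMul v u p = faceMul v u q ↔ v p = v q ∧ u p = u q := by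
  have h1 := @faceMul_lt_faceMul n v u p q
  have h2 := @faceMul_lt_faceMul n v u q p
  constructor
  · intro h
    rw [h] at h1 h2
    simp only [lt_irrefl, false_iff, not_or, not_and, not_lt] at h1 h2
    have h3 := le_antisymm h2.1 h1.1
    exact ⟨h3, le_antisymm (h2.2 h3.symm) (h1.2 h3)⟩
  · rintro ⟨h3, h4⟩
    simp [faceMul, h3, h4]

/-- The vectors lie in the same face of the arrangement of type `D`. -/
def SameFace (v u : SignedPoint n → ℤ) : Prop :=
  ∀ p q : SignedPoint n, q ≠ -p → (v p < v q ↔ u p < u q)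

theorem ne_neg_symm {p q : SignedPoint n} (h : q ≠ -p) : p ≠ -q := by
  rintro rfl
  exact h (neg_neg q).symm

theorem SameFace.symm {v u : SignedPoint n → ℤ} (h : SameFace v u) : SameFace u v :=
  fun p q hpq => (h p q hpq).symm

theorem SameFace.trans {v u w : SignedPoint n → ℤ} (h : SameFace v u) (h' : SameFace u w) :
    SameFace v w := fun p q hpq => (h p q hpq).trans (h' p q hpq)

theorem SameFace.eq_iff {v u : SignedPoint n → ℤ} (h : SameFace v u) {p q : SignedPoint n}
    (hpq : q ≠ -p) : v p = v q ↔ u p = u q := by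
  have h1 := h p q hpq
  have h2 := h q p (ne_neg_symm hpq)
  constructor <;> intro e <;> apply le_antisymm <;> by_contra! hc
  · exact (h2.2 hc).ne e.symm
  · exact (h1.2 hc).ne e
  · exact (h2.1 hc).ne e.symm
  · exact (h1.1 hc).ne e

theorem SameFace.faceMul {v v' u u' : SignedPoint n → ℤ} (h : SameFace v v') (h' : SameFace u u') :
    SameFace (faceMul v u) (faceMul v' u') := by
  intro p q hpq
  rw [faceMul_lt_faceMul, faceMul_lt_faceMul, h p q hpq, h' p q hpq, h.eq_iff hpq]

theorem sameFace_refl (v : SignedPoint n → ℤ) : SameFace v v := fun _ _ _ => Iff.rfl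

/-- Both sides compare points lexicographically by `v`, `u`, `w`. The scale factors differ, so
associativity holds for faces and not for the vectors. -/
theorem sameFace_faceMul_assoc (v u w : SignedPoint n → ℤ) :
    SameFace (faceMul (faceMul v u) w) (faceMul v (faceMul u w)) := by
  intro p q _
  simp only [faceMul_lt_faceMul, faceMul_eq_faceMul]
  tauto

theorem StrictDominant.of_sameFace {v u : SignedPoint n → ℤ} (hv : StrictDominant v)
    (h : SameFace v u) : StrictDominant u := fun p q hpq => (h p q hpq.2).1 (hv p q hpq)

theorem StrictDominant.sameFace {v u : SignedPoint n → ℤ} (hv : StrictDominant v)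
    (hu : StrictDominant u) : SameFace v u := by
  intro p q hpq
  rcases lt_trichotomy p q with h | h | h
  · exact iff_of_true (hv p q ⟨h, hpq⟩) (hu p q ⟨h, hpq⟩)
  · subst h
    simp
  · exact iff_of_false (hv q p ⟨h, ne_neg_symm hpq⟩).not_gt (hu q p ⟨h, ne_neg_symm hpq⟩).not_gt

/-! ### Vanishing roots, and how the face product reduces them. -/

open Classical in
/-- The roots that vanish on a vector. -/
noncomputable def zeroSet (v : SignedPoint n → ℤ) : Finset (SignedPoint n × SignedPoint n) :=
  Finset.univ.filter fun x => x.2 ≠ -x.1 ∧ v x.1 = v x.2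

theorem mem_zeroSet {v : SignedPoint n → ℤ} {x : SignedPoint n × SignedPoint n} :
    x ∈ zeroSet v ↔ x.2 ≠ -x.1 ∧ v x.1 = v x.2 := by
  simp [zeroSet]

theorem zeroSet_subset_iff {v u : SignedPoint n → ℤ} :
    zeroSet v ⊆ zeroSet u ↔ ∀ p q : SignedPoint n, q ≠ -p → v p = v q → u p = u q := by
  constructor
  · intro h p q hpq e
    exact (mem_zeroSet.1 (h (mem_zeroSet.2 ⟨hpq, e⟩ : (p, q) ∈ zeroSet v))).2
  · rintro h ⟨p, q⟩ hx
    rw [mem_zeroSet] at hx ⊢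
    exact ⟨hx.1, h p q hx.1 hx.2⟩

theorem zeroSet_faceMul_subset (v u : SignedPoint n → ℤ) : zeroSet (faceMul v u) ⊆ zeroSet v :=
  zeroSet_subset_iff.2 fun _ _ _ h => (faceMul_eq_faceMul.1 h).1

/-- If all roots that vanish on `v` vanish on `u`, then multiplying the face of `v` by that of `u`
does not change it. -/
theorem sameFace_faceMul_of_subset {v u : SignedPoint n → ℤ} (h : zeroSet v ⊆ zeroSet u) :
    SameFace (faceMul v u) v := by
  intro p q hpq
  rw [faceMul_lt_faceMul]
  constructor
  · rintro (h1 | ⟨h1, h2⟩)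
    · exact h1
    · exact absurd (zeroSet_subset_iff.1 h p q hpq h1) h2.ne
  · exact Or.inl

theorem card_zeroSet_faceMul_lt {v u : SignedPoint n → ℤ} (h : ¬ zeroSet v ⊆ zeroSet u) :
    (zeroSet (faceMul v u)).card < (zeroSet v).card := by
  refine Finset.card_lt_card ((zeroSet_faceMul_subset v u).ssubset_of_ne fun e => h ?_)
  rw [← e]
  exact zeroSet_subset_iff.2 fun _ _ _ h => (faceMul_eq_faceMul.1 h).2

variable [hn : n.AtLeastTwo]

noncomputable instance instFintypeDGroup : Fintype (DGroup n) := Fintype.ofFinite _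

theorem pull_faceMul (v u : SignedPoint n → ℤ) (g : DGroup n) :
    pull (faceMul v u) g = faceMul (pull v g) (pull u g) := by
  funext p
  simp only [pull_apply, faceMul]
  rw [Equiv.sum_comp g.1 fun q => |u q|]

theorem SameFace.pull {v u : SignedPoint n → ℤ} (h : SameFace v u) (g : DGroup n) :
    SameFace (pull v g) (pull u g) := fun p q hpq =>
  h _ _ ((ne_neg_pull_iff g p q).2 hpq)

theorem zeroSet_pull_subset {v u : SignedPoint n → ℤ} (h : zeroSet v ⊆ zeroSet u)
    (g : DGroup n) : zeroSet (pull v g) ⊆ zeroSet (pull u g) := by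
  rw [zeroSet_subset_iff] at *
  exact fun p q hpq e => h _ _ ((ne_neg_pull_iff g p q).2 hpq) e

theorem zeroSet_pull_subset_iff {v u : SignedPoint n → ℤ} (g : DGroup n) :
    zeroSet (pull v g) ⊆ zeroSet (pull u g) ↔ zeroSet v ⊆ zeroSet u := by
  refine ⟨fun h => ?_, fun h => zeroSet_pull_subset h g⟩
  have := zeroSet_pull_subset h g⁻¹
  rwa [pull_pull, pull_pull, mul_inv_cancel, pull_one, pull_one] at this

theorem card_zeroSet_pull (v : SignedPoint n → ℤ) (g : DGroup n) :
    (zeroSet (pull v g)).card = (zeroSet v).card := by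
  refine Finset.card_bij (fun x _ => (g.1 x.1, g.1 x.2)) ?_ ?_ ?_
  · rintro ⟨p, q⟩ h
    rw [mem_zeroSet] at h ⊢
    exact ⟨(ne_neg_pull_iff g p q).2 h.1, h.2⟩
  · rintro ⟨p, q⟩ - ⟨p', q'⟩ - h
    simpa using h
  · rintro ⟨p, q⟩ h
    refine ⟨((g⁻¹).1 p, (g⁻¹).1 q), ?_, by simp⟩
    rw [mem_zeroSet] at h ⊢
    refine ⟨(ne_neg_pull_iff g⁻¹ p q).2 h.1, ?_⟩
    simpa [pull_apply] using h.2

/-! ### Stabilizers -/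

/-- The group elements that fix a vector. -/
def stab (v : SignedPoint n → ℤ) : Subgroup (DGroup n) where
  carrier := {g | pull v g = v}
  one_mem' := pull_one v
  mul_mem' {a b} ha hb := by
    simp only [Set.mem_ofPred_eq] at *
    rw [← pull_pull, ha, hb]
  inv_mem' {a} ha := by
    simp only [Set.mem_ofPred_eq] at *
    conv_lhs => rw [← ha]
    rw [pull_pull, mul_inv_cancel, pull_one]

theorem mem_stab {v : SignedPoint n → ℤ} {g : DGroup n} : g ∈ stab v ↔ pull v g = v := Iff.rfl

/-- The simple reflections that fix a vector. -/
def vecType (v : SignedPoint n → ℤ) : Set (Fin n) := {i | v (rootLo i) = v (rootHi i)}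

theorem closure_le_stab {v : SignedPoint n → ℤ} (hv : OddVec v) {J : Set (Fin n)}
    (hJ : J ⊆ vecType v) : Subgroup.closure (gen n '' J) ≤ stab v := by
  rw [Subgroup.closure_le]
  rintro _ ⟨i, hi, rfl⟩
  exact pull_gen_eq_self hv (hJ hi)

/-- The closed chamber is a fundamental domain, and stabilizers of its points are generated by
simple reflections. -/
theorem mem_closure_of_dominant_pull {v : SignedPoint n → ℤ} (hv : OddVec v) (hd : Dominant v)
    (g : DGroup n) (hg : Dominant (pull v g)) :
    pull v g = v ∧ g ∈ Subgroup.closure (gen n '' vecType v) := by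
  induction h : (invSet (pull (rho n) g)).card using Nat.strong_induction_on generalizing g with
  | _ N ih =>
    by_cases hdg : Dominant (pull (rho n) g)
    · rw [eq_one_of_dominant hdg]
      exact ⟨pull_one v, one_mem _⟩
    · obtain ⟨i, hi⟩ := exists_gen_desc ((oddVec_rho n).pull g) hdg
      have h1 := card_invSet_pull_gen_add_two ((oddVec_rho n).pull g) hi
      rw [pull_pull] at h1
      -- `g` reverses the root `i`. Dominance of `pull v g` gives one inequality and dominance of
      -- `v`, at the reversed pair, gives the other. Hence `gen n i` fixes `pull v g` and may be
      -- removed from the right of `g`.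
      have h2 : pull v g (rootLo i) = pull v g (rootHi i) := by
        refine le_antisymm (hg _ _ (posPair_root i)) (hd _ _ ⟨hi, ?_⟩)
        rw [ne_neg_pull_iff]
        exact ne_neg_symm (posPair_root i).2
      have h3 : pull v (g * gen n i) = pull v g := by
        rw [← pull_pull, pull_gen_eq_self (hv.pull g) h2]
      obtain ⟨h4, h5⟩ := ih _ (by omega) (g * gen n i) (by rwa [h3]) rfl
      have h6 : pull v g = v := h3.symm.trans h4
      refine ⟨h6, ?_⟩
      have h7 : gen n i ∈ Subgroup.closure (gen n '' vecType v) := by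
        refine Subgroup.subset_closure ⟨i, ?_, rfl⟩
        rw [h6] at h2
        exact h2
      have := mul_mem h5 h7
      rwa [mul_assoc, gen_mul_gen, mul_one] at this

/-- The stabilizer of `v` is generated by simple reflections whose roots vanish on `v`, hence on
`u`. -/
theorem stab_le_of_zeroSet_subset {v u : SignedPoint n → ℤ} (hv : OddVec v) (hd : Dominant v)
    (hu : OddVec u) (h : zeroSet v ⊆ zeroSet u) : stab v ≤ stab u := by
  intro g hg
  refine closure_le_stab hu ?_ (mem_closure_of_dominant_pull hv hd g ?_).2
  · exact fun i hi => zeroSet_subset_iff.1 h _ _ (posPair_root i).2 hi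
  · rwa [mem_stab.1 hg]

theorem card_stab_pull (v : SignedPoint n → ℤ) (g : DGroup n) :
    Nat.card (stab (pull v g)) = Nat.card (stab v) := by
  refine Nat.card_congr ((MulAut.conj g).toEquiv.subtypeEquiv fun h => ?_)
  simp only [mem_stab, MulEquiv.toEquiv_eq_coe, EquivLike.coe_coe, MulAut.conj_apply]
  constructor
  · intro e
    rw [← pull_pull, ← pull_pull, pull_pull v g h] at *
    rw [e, pull_pull, mul_inv_cancel, pull_one]
  · intro e
    conv_rhs => rw [← e]
    rw [pull_pull, pull_pull]
    congr 1
    group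

theorem card_stab_le {v u : SignedPoint n → ℤ} (hv : OddVec v) (hd : Dominant v)
    (hu : OddVec u) (g : DGroup n) (h : zeroSet v ⊆ zeroSet (pull u g)) :
    Nat.card (stab v) ≤ Nat.card (stab u) := by
  rw [← card_stab_pull u g]
  exact Nat.card_le_card_of_injective _
    (Subgroup.inclusion_injective (stab_le_of_zeroSet_subset hv hd (hu.pull g) h))

/-! ### Minimal coset representatives -/

/-- A descent of `w` in `J` would shorten `w` inside its coset. Conversely, without such descents
`v` refined by `pull (rho n) w` is strictly dominant, so each pair inverted by `w` has `v p < v q`.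
An element `u` of `W_J` fixes `v`, so `u⁻¹` keeps such pairs positive and maps the inversions of `w`
injectively into those of `w * u`. -/
theorem minCosetReps_iff {v : SignedPoint n → ℤ} (hv : OddVec v) (hd : Dominant v)
    (w : DGroup n) : w ∈ minCosetReps (genSet n) (gen n '' vecType v) ↔
      ∀ i ∈ vecType v, pull (rho n) w (rootLo i) < pull (rho n) w (rootHi i) := by
  classical
  have hrho := (oddVec_rho n).pull w
  constructor
  · intro h i hi
    by_contra! hc
    have hne : pull (rho n) w (rootHi i) ≠ pull (rho n) w (rootLo i) := fun e =>
      (posPair_root i).1.ne' (w.1.injective (Subtype.ext e))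
    have h1 := h _ (Subgroup.subset_closure ⟨i, hi, rfl⟩)
    rw [wordLength_le_iff, ← pull_pull] at h1
    have := card_invSet_pull_gen_add_two hrho (lt_of_le_of_ne hc hne)
    omega
  · intro h u hu
    rw [wordLength_le_iff]
    have hu' : pull v u = v := closure_le_stab hv subset_rfl hu
    have hmul : StrictDominant (faceMul v (pull (rho n) w)) := by
      refine strictDominant_of_simple (hv.faceMul hrho) fun i => ?_
      rw [faceMul_lt_faceMul]
      rcases (hd _ _ (posPair_root i)).lt_or_eq with h1 | h1
      · exact Or.inl h1
      · exact Or.inr ⟨h1, h i h1⟩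
    refine Finset.card_le_card_of_injOn (fun x => ((u⁻¹).1 x.1, (u⁻¹).1 x.2)) ?_ ?_
    · rintro ⟨p, q⟩ hx
      simp only [Finset.mem_coe, mem_invSet] at hx ⊢
      obtain ⟨h1, h2⟩ := hx
      have h3 : v p < v q := by
        rcases faceMul_lt_faceMul.1 (hmul p q h1) with h3 | ⟨-, h3⟩
        · exact h3
        · exact absurd h2 h3.not_gt
      have hinv : pull v u⁻¹ = v := (stab v).inv_mem hu'
      refine ⟨⟨?_, (ne_neg_pull_iff _ _ _).2 h1.2⟩, ?_⟩
      · by_contra! hc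
        have hc' : (u⁻¹).1 q < (u⁻¹).1 p :=
          lt_of_le_of_ne hc fun e => h1.1.ne' ((u⁻¹).1.injective e)
        have := hd _ _ ⟨hc', (ne_neg_pull_iff _ _ _).2 (ne_neg_symm h1.2)⟩
        rw [← hinv] at h3
        exact absurd h3 this.not_gt
      · simpa [pull_apply] using h2
    · rintro ⟨p, q⟩ - ⟨p', q'⟩ - h
      simpa using h

end

/-! ### The product of sums over orbits of faces -/

section
variable {n : ℕ} [hn : n.AtLeastTwo]

theorem exists_strictDominant_pull_faceMul {v u : SignedPoint n → ℤ} (hv : OddVec v)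
    (hu : OddVec u) (hinj : Function.Injective u) :
    ∃ w : DGroup n, StrictDominant (pull (faceMul v u) w) := by
  obtain ⟨w, hw⟩ := exists_dominant_pull (hv.faceMul hu)
  refine ⟨w, fun p q hpq => lt_of_le_of_ne (hw p q hpq) fun e => ?_⟩
  have := (faceMul_eq_faceMul.1 e).2
  exact hpq.1.ne (w.1.injective (hinj this))

theorem rho_injective : Function.Injective (rho n) := fun _ _ h => Subtype.ext h

open Classical in
/-- The group element `w` for which `w C` is the product of the face of `v` and of the fundamental
chamber `C`. -/
noncomputable def chamber (v : SignedPoint n → ℤ) : DGroup n :=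
  if h : ∃ w : DGroup n, StrictDominant (pull (faceMul v (rho n)) w) then h.choose else 1

theorem chamber_spec {v : SignedPoint n → ℤ} (hv : OddVec v) :
    StrictDominant (pull (faceMul v (rho n)) (chamber v)) := by
  have h := exists_strictDominant_pull_faceMul hv (oddVec_rho n) rho_injective
  rw [chamber, dif_pos h]
  exact h.choose_spec

theorem eq_chamber {v : SignedPoint n → ℤ} (hv : OddVec v) {w : DGroup n}
    (hw : StrictDominant (pull (faceMul v (rho n)) w)) : w = chamber v := by
  have h := chamber_spec hv
  have h2 : pull (faceMul v (rho n)) (chamber v) =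
      pull (pull (faceMul v (rho n)) w) (w⁻¹ * chamber v) := by
    rw [pull_pull, mul_inv_cancel_left]
  rw [h2] at h
  exact inv_mul_eq_one.1 (eq_one_of_strictDominant_pull hw h)

theorem chamber_congr {v v' : SignedPoint n → ℤ} (hv : OddVec v) (hv' : OddVec v')
    (h : SameFace v v') : chamber v = chamber v' :=
  eq_chamber hv' ((chamber_spec hv).of_sameFace ((h.faceMul (sameFace_refl _)).pull _))

/-- Let `F`, `G` be the faces of `u`, `v` and let `wC = FC`. Then `w(GC) = (wG)(wC) = (wG)(FC) =
((wG)F)C`, by equivariance and associativity; `wG` is the face of `pull v w⁻¹`. -/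
theorem chamber_mul_chamber {u v : SignedPoint n → ℤ} (hu : OddVec u) (hv : OddVec v) :
    chamber u * chamber v = chamber (faceMul (pull v (chamber u)⁻¹) u) := by
  refine eq_chamber ((hv.pull _).faceMul hu) ?_
  rw [← pull_pull]
  have h1 : SameFace (pull (faceMul (faceMul (pull v (chamber u)⁻¹) u) (rho n)) (chamber u))
      (faceMul v (rho n)) := by
    refine ((sameFace_faceMul_assoc _ _ _).pull _).trans ?_
    rw [pull_faceMul, pull_pull, inv_mul_cancel, pull_one]
    exact (sameFace_refl v).faceMul ((chamber_spec hu).sameFace fun p q h => h.1)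
  exact (chamber_spec hv).of_sameFace (h1.pull _).symm

/-- The translates of the face of `v` correspond to the left cosets of its stabilizer, and the
projection of `C` onto such a translate is the minimal element of the coset. -/
theorem chamber_pull_eq_iff {v : SignedPoint n → ℤ} (hv : OddVec v) (hd : Dominant v)
    (g w : DGroup n) : chamber (pull v g⁻¹) = w ↔
      w ∈ minCosetReps (genSet n) (gen n '' vecType v) ∧ g⁻¹ * w ∈ stab v := by
  have hrho := (oddVec_rho n).pull w
  constructor
  · rintro rfl
    have h := chamber_spec (hv.pull g⁻¹)
    rw [pull_faceMul, pull_pull] at h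
    have hd' : Dominant (pull v (g⁻¹ * chamber (pull v g⁻¹))) := by
      intro p q hpq
      rcases faceMul_lt_faceMul.1 (h p q hpq) with h1 | h1
      · exact h1.le
      · exact h1.1.le
    have h1 := (mem_closure_of_dominant_pull hv hd _ hd').1
    refine ⟨(minCosetReps_iff hv hd _).2 fun i hi => ?_, h1⟩
    rw [h1] at h
    rcases faceMul_lt_faceMul.1 (h _ _ (posPair_root i)) with h2 | h2
    · exact absurd hi h2.ne
    · exact h2.2
  · rintro ⟨h1, h2⟩
    symm
    refine eq_chamber (hv.pull _) ?_
    rw [pull_faceMul, pull_pull, mem_stab.1 h2]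
    refine strictDominant_of_simple (hv.faceMul hrho) fun i => ?_
    rw [faceMul_lt_faceMul]
    rcases (hd _ _ (posPair_root i)).lt_or_eq with h3 | h3
    · exact Or.inl h3
    · exact Or.inr ⟨h3, (minCosetReps_iff hv hd _).1 h1 i h3⟩

variable (k : Type*) [Field k]

/-- The sum over the orbit of (the face of) a vector, each face being represented by its product
with the fundamental chamber. -/
noncomputable def orbitSum (v : SignedPoint n → ℤ) : MonoidAlgebra k (DGroup n) :=
  ∑ h : DGroup n, MonoidAlgebra.of k _ (chamber (pull v h))

theorem orbitSum_pull (v : SignedPoint n → ℤ) (g : DGroup n) :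
    orbitSum k (pull v g) = orbitSum k v := by
  unfold orbitSum
  simp only [pull_pull]
  exact Equiv.sum_comp (Equiv.mulLeft g) fun h => MonoidAlgebra.of k _ (chamber (pull v h))

theorem orbitSum_congr {v v' : SignedPoint n → ℤ} (hv : OddVec v) (hv' : OddVec v')
    (h : SameFace v v') : orbitSum k v = orbitSum k v' :=
  Finset.sum_congr rfl fun g _ => by rw [chamber_congr (hv.pull g) (hv'.pull g) (h.pull g)]

/-- By `chamber_mul_chamber` the product is a double sum in which the second face is translated by
the inverse of `chamber (pull u g)`. Reindexing `h` absorbs this translation, and replacing `g` by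
`g * h` lets `h` act on the whole face product. -/
theorem orbitSum_mul_orbitSum {u v : SignedPoint n → ℤ} (hu : OddVec u) (hv : OddVec v) :
    orbitSum k u * orbitSum k v = ∑ g : DGroup n, orbitSum k (faceMul v (pull u g)) := by
  have h1 : ∀ g : DGroup n, MonoidAlgebra.of k _ (chamber (pull u g)) * orbitSum k v =
      ∑ h : DGroup n, MonoidAlgebra.of k _ (chamber (faceMul (pull v h) (pull u g))) := by
    intro g
    unfold orbitSum
    rw [Finset.mul_sum, ← Equiv.sum_comp (Equiv.mulRight (chamber (pull u g))⁻¹)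
      fun h => MonoidAlgebra.of k _ (chamber (faceMul (pull v h) (pull u g)))]
    refine Finset.sum_congr rfl fun h _ => ?_
    rw [← map_mul, chamber_mul_chamber (hu.pull g) (hv.pull h), pull_pull]
    rfl
  conv_lhs => rw [orbitSum, Finset.sum_mul]
  simp only [h1]
  simp only [orbitSum]
  rw [Finset.sum_comm]
  conv_rhs => rw [Finset.sum_comm]
  refine Finset.sum_congr rfl fun h _ => ?_
  rw [← Equiv.sum_comp (Equiv.mulRight h)]
  refine Finset.sum_congr rfl fun g _ => ?_
  rw [pull_faceMul, pull_pull]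
  rfl

/-- `orbitSum` runs over the group and not over the orbit, so each face is counted once for every
element of the stabilizer. -/
theorem orbitSum_of_dominant {v : SignedPoint n → ℤ} (hv : OddVec v) (hd : Dominant v) :
    orbitSum k v = (Nat.card (stab v) : k) • cosetSum k (genSet n) (gen n '' vecType v) := by
  classical
  unfold orbitSum cosetSum
  rw [← Equiv.sum_comp (Equiv.inv (DGroup n)), Finset.smul_sum,
    ← Finset.sum_fiberwise_of_maps_to
      (t := (Set.toFinite (minCosetReps (genSet n) (gen n '' vecType v))).toFinset)
      (g := fun g : DGroup n => chamber (pull v g⁻¹))]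
  · refine Finset.sum_congr rfl fun w hw => ?_
    rw [Set.Finite.mem_toFinset] at hw
    rw [Finset.sum_congr rfl (g := fun _ => MonoidAlgebra.of k _ w), Finset.sum_const,
      ← Nat.cast_smul_eq_nsmul k]
    · congr 2
      rw [Nat.subtype_card (Finset.univ.filter fun g => g ∈ stab v) (by simp)]
      refine Finset.card_nbij' (fun g => g⁻¹ * w) (fun g => w * g⁻¹) ?_ ?_ ?_ ?_
      · intro g hg
        have h1 := (chamber_pull_eq_iff hv hd g w).1 (Finset.mem_filter.1 hg).2
        simpa using h1.2
      · intro g hg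
        have hg' : g ∈ stab v := by simpa using hg
        have h1 := (chamber_pull_eq_iff hv hd (w * g⁻¹) w).2 ⟨hw, by simpa using hg'⟩
        simpa using h1
      · intro g _
        simp
      · intro g _
        simp
    · intro g hg
      rw [← (Finset.mem_filter.1 hg).2]
      rfl
  · intro g _
    rw [Set.Finite.mem_toFinset]
    exact ((chamber_pull_eq_iff hv hd g _).1 rfl).1

end

/-! ### Vectors attached to labels -/

/-- With blocks of sizes `l` following the points `1, …, d`, the number of the block that
contains `x`, counted from `1`; it is `0` if `x ≤ d`. -/
def level : ℕ → List ℕ → ℕ → ℕ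
  | _, [], _ => 0
  | d, a :: l, x => if d < x then level (d + a) l x + 1 else 0

/-- The level of `x` counts the block boundaries `d`, `d + l₀`, `d + l₀ + l₁`, … that lie strictly
below `x`. -/
theorem lt_level_iff {l : List ℕ} : ∀ {d x j : ℕ},
    j < level d l x ↔ j < l.length ∧ d + (l.take j).sum < x := by
  induction l with
  | nil => intro d x j; simp [level]
  | cons a l ih =>
    intro d x j
    unfold level
    cases j with
    | zero => split_ifs with h <;> simp [h]
    | succ j =>
      split_ifs with h
      · rw [Nat.add_lt_add_iff_right, ih]
        simp [add_assoc]
      · simp only [Nat.not_lt_zero, List.length_cons, Nat.add_lt_add_iff_right, List.take_succ_cons,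
          List.sum_cons, false_iff, not_and]
        intro _
        omega

theorem level_mono (d : ℕ) (l : List ℕ) : Monotone (level d l) := by
  intro x y hxy
  by_contra! h
  have := (lt_level_iff.1 h).2
  exact lt_irrefl _ (lt_level_iff.2 ⟨(lt_level_iff.1 h).1, by omega⟩)

theorem level_succ_eq_iff {d : ℕ} {l : List ℕ} {x : ℕ} :
    level d l x = level d l (x + 1) ↔ ¬ ∃ j < l.length, d + (l.take j).sum = x := by
  constructor
  · rintro h ⟨j, hj, hx⟩
    have h1 : j < level d l (x + 1) := lt_level_iff.2 ⟨hj, by omega⟩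
    rw [← h, lt_level_iff] at h1
    omega
  · intro h
    refine le_antisymm (level_mono d l (Nat.le_succ x)) ?_
    by_contra! hc
    have h1 := lt_level_iff.1 hc
    have h2 := mt lt_level_iff.2 (lt_irrefl (level d l x))
    exact h ⟨_, h1.1, by have := h1.2; have := fun h => h2 ⟨h1.1, h⟩; omega⟩

theorem level_pos_iff {d : ℕ} {l : List ℕ} {x : ℕ} : 0 < level d l x ↔ l ≠ [] ∧ d < x := by
  rw [lt_level_iff, List.length_pos_iff]
  simp

theorem level_le_length (d : ℕ) (l : List ℕ) (x : ℕ) : level d l x ≤ l.length := by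
  by_contra! h
  exact lt_irrefl _ (lt_level_iff.1 h).1

theorem level_eq_succ_iff {d : ℕ} {l : List ℕ} {x j : ℕ} (hj : j < l.length)
    (hx : x ≤ d + l.sum) :
    level d l x = j + 1 ↔ x ∈ Finset.Ioc (d + (l.take j).sum) (d + (l.take j).sum + l[j]) := by
  have h1 := @lt_level_iff l d x j
  have h2 := @lt_level_iff l d x (j + 1)
  have h3 : (l.take (j + 1)).sum = (l.take j).sum + l[j] := List.sum_take_succ l j hj
  rw [Finset.mem_Ioc]
  rcases lt_or_ge (j + 1) l.length with h4 | h4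
  · rw [h3] at h2
    constructor
    · intro h
      have h5 := h1.1 (by omega)
      refine ⟨h5.2, ?_⟩
      by_contra! hc
      have := h2.2 ⟨h4, by omega⟩
      omega
    · rintro ⟨h5, h6⟩
      have := h1.2 ⟨hj, h5⟩
      have : ¬ (j + 1 < level d l x) := fun h => by have := (h2.1 h).2; omega
      omega
  · have h5 : (l.take (j + 1)).sum = l.sum := by rw [List.take_of_length_le h4]
    have h6 := level_le_length d l x
    constructor
    · intro h
      have h7 := h1.1 (by omega)
      exact ⟨h7.2, by omega⟩
    · rintro ⟨h7, h8⟩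
      have := h1.2 ⟨hj, h7⟩
      omega

/-- Every set of partial sums that contains `0` comes from a list of positive integers. -/
theorem exists_list_sums (m : ℕ) (B : Finset ℕ) (hB : ∀ b ∈ B, b < m) (h0 : 0 < m → 0 ∈ B) :
    ∃ l : List ℕ, (∀ x ∈ l, 0 < x) ∧ l.sum = m ∧
      ∀ x, (∃ j < l.length, (l.take j).sum = x) ↔ x ∈ B := by
  induction m using Nat.strong_induction_on generalizing B with
  | _ m ih =>
    rcases Nat.eq_zero_or_pos m with rfl | hm
    · exact ⟨[], by simp, rfl, fun x => ⟨by simp, fun h => absurd (hB x h) (Nat.not_lt_zero x)⟩⟩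
    · have hne : B.Nonempty := ⟨0, h0 hm⟩
      -- The largest element of `B` is where the last block begins; the blocks before it come from
      -- the induction hypothesis.
      have ha := B.max'_mem hne
      set a := B.max' hne with ha_def
      obtain ⟨l, hl1, hl2, hl3⟩ := ih a (hB a ha) (B.filter (· < a))
        (fun b hb => (Finset.mem_filter.1 hb).2) fun h => Finset.mem_filter.2 ⟨h0 hm, h⟩
      have ham := hB a ha
      refine ⟨l ++ [m - a], ?_, ?_, fun x => ?_⟩
      · intro x hx
        rcases List.mem_append.1 hx with hx | hx
        · exact hl1 x hx
        · rw [List.mem_singleton.1 hx]; omega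
      · rw [List.sum_append, hl2, List.sum_singleton]; omega
      · constructor
        · rintro ⟨j, hj, rfl⟩
          rw [List.length_append, List.length_singleton] at hj
          rw [List.take_append_of_le_length (by omega)]
          rcases Nat.lt_succ_iff_lt_or_eq.1 hj with hj | rfl
          · exact (Finset.mem_filter.1 ((hl3 _).1 ⟨j, hj, rfl⟩)).1
          · rwa [List.take_length, hl2]
        · intro hx
          rcases (B.le_max' x hx).lt_or_eq with hxa | hxa
          · obtain ⟨j, hj, hjx⟩ := (hl3 x).2 (Finset.mem_filter.2 ⟨hx, hxa⟩)
            refine ⟨j, by simp; omega, ?_⟩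
            rw [List.take_append_of_le_length (by omega), hjx]
          · refine ⟨l.length, by simp, ?_⟩
            rw [List.take_append_of_le_length le_rfl, List.take_length, hl2, hxa]

/-- The bound on the sum excludes `[1]`, for which `1` is the total and not a proper partial sum. -/
theorem head_eq_one_iff {l : List ℕ} (hl : ∀ x ∈ l, 0 < x) (hs : 2 ≤ l.sum) :
    (∃ j < l.length, (l.take j).sum = 1) ↔ l.head? = some 1 := by
  cases l with
  | nil => simp at hs
  | cons a l =>
    simp only [List.head?_cons, Option.some.injEq]
    have ha := hl a (by simp)
    constructor
    · rintro ⟨j, hj, h⟩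
      cases j with
      | zero => simp at h
      | succ j => simp at h; omega
    · rintro rfl
      cases l with
      | nil => simp at hs
      | cons b l => exact ⟨1, by simp, by simp⟩

namespace DComp

variable {n : ℕ}

theorem components_pos (κ : DComp n) : ∀ x ∈ κ.components, 0 < x := by
  cases κ <;> exact fun x hx => Composition.blocks_pos _ hx

theorem sum_components_le (κ : DComp n) : κ.components.sum ≤ n := by
  cases κ with
  | below m hm c => simp only [components, Composition.blocks_sum]; omega
  | one c hc => simp [components]
  | full c hc => simp [components]
  | fullPrime c hc => simp [components]

/-- The number of points before the first block. -/
def offset (κ : DComp n) : ℕ := n - κ.components.sum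

theorem offset_add_sum (κ : DComp n) : κ.offset + κ.components.sum = n := by
  have := κ.sum_components_le
  unfold offset
  omega

/-- Compositions of `n - 1` are not labels: a single zero coordinate cannot be detected in type D,
where `p` and `-p` form no root. -/
theorem offset_ne_one (κ : DComp n) : κ.offset ≠ 1 := by
  unfold offset
  cases κ with
  | below m hm c => simp only [components, Composition.blocks_sum]; omega
  | one c hc => simp [components]
  | full c hc => simp [components]
  | fullPrime c hc => simp [components]

theorem InFullPrime.offset {κ : DComp n} (h : κ.InFullPrime) : κ.offset = 0 := by
  cases κ <;> simp_all [InFullPrime, components, DComp.offset]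

theorem InFullPrime.head {κ : DComp n} (h : κ.InFullPrime) :
    κ.components.head? ≠ some 1 := by
  cases κ <;> simp_all [InFullPrime, components]
  rename_i hc
  obtain ⟨a, ha, ha'⟩ := hc
  rw [ha']
  simp
  omega

theorem components_ne_nil {κ : DComp n} (hn : 0 < n) (h : κ.offset = 0) :
    κ.components ≠ [] := by
  intro e
  have := κ.offset_add_sum
  rw [h, e] at this
  simp at this
  omega

open Classical in
/-- The sign by which the coordinate `x` is multiplied for labels in
the second copy of the compositions with first component at least two. -/
noncomputable def flip (κ : DComp n) (x : ℕ) : ℤ := if κ.InFullPrime ∧ x = 1 then -1 else 1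

theorem flip_of_ne_one (κ : DComp n) {x : ℕ} (h : x ≠ 1) : κ.flip x = 1 :=
  if_neg fun h' => h h'.2

theorem flip_of_not {κ : DComp n} (h : ¬ κ.InFullPrime) (x : ℕ) : κ.flip x = 1 :=
  if_neg fun h' => h h'.1

theorem InFullPrime.flip_one {κ : DComp n} (h : κ.InFullPrime) : κ.flip 1 = -1 :=
  if_pos ⟨h, rfl⟩

theorem flip_eq_or (κ : DComp n) (x : ℕ) : κ.flip x = 1 ∨ κ.flip x = -1 := by
  unfold flip
  split_ifs <;> simp

/-- A vector of the closed fundamental chamber that is fixed by exactly the simple reflections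
outside of the subset corresponding to the label. -/
noncomputable def vec (κ : DComp n) (p : SignedPoint n) : ℤ :=
  κ.flip p.1.natAbs * p.1.sign * (level κ.offset κ.components p.1.natAbs : ℤ)

theorem oddVec_vec (κ : DComp n) : OddVec κ.vec := fun p => by
  simp only [vec, val_neg, Int.natAbs_neg, Int.sign_neg]
  ring

theorem vec_of_val (κ : DComp n) {p : SignedPoint n} {x : ℕ} (hx : 0 < x) (hp : p.1 = x) :
    κ.vec p = κ.flip x * (level κ.offset κ.components x : ℤ) := by
  rw [vec, hp, Int.sign_eq_one_of_pos (by omega), Int.natAbs_natCast, mul_one]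

theorem natAbs_vec (κ : DComp n) (p : SignedPoint n) :
    (κ.vec p).natAbs = level κ.offset κ.components p.1.natAbs := by
  have := p.2.1
  rw [vec, Int.natAbs_mul, Int.natAbs_mul, Int.natAbs_sign_of_ne_zero this]
  rcases κ.flip_eq_or p.1.natAbs with h | h <;> simp [h]

theorem vec_eq_zero_iff (κ : DComp n) (p : SignedPoint n) :
    κ.vec p = 0 ↔ p.1.natAbs ≤ κ.offset := by
  have h1 := @level_pos_iff κ.offset κ.components p.1.natAbs
  rw [← Int.natAbs_eq_zero, natAbs_vec]
  have h2 := p.2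
  have h3 := κ.offset_add_sum
  constructor
  · intro h
    by_contra! hc
    rw [h] at h1
    have : κ.components ≠ [] := fun e => by
      rw [e] at h3
      simp at h3
      omega
    exact absurd (h1.2 ⟨this, hc⟩) (lt_irrefl 0)
  · intro h
    by_contra hc
    have := (h1.1 (Nat.pos_of_ne_zero hc)).2
    omega

variable [hn : n.AtLeastTwo]

theorem mem_indexSet_of_two_le (κ : DComp n) {i : Fin n} (hi : 2 ≤ (i : ℕ)) :
    i ∈ κ.indexSet ↔ ∃ j < κ.components.length, κ.offset + (κ.components.take j).sum = i := by
  cases κ with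
  | below m hm c =>
    simp [indexSet, components, offset, Composition.sizeUpTo, eq_comm]
  | one c hc | full c hc | fullPrime c hc =>
    simp only [indexSet, components, offset, Composition.sizeUpTo, Set.mem_ofPred_eq,
      Composition.blocks_sum, Nat.sub_self, zero_add, Composition.blocks_length]
    constructor
    · rintro (h | ⟨j, -, h1, h2⟩)
      · omega
      · exact ⟨j, h1, h2.symm⟩
    · rintro ⟨j, h1, h2⟩
      refine Or.inr ⟨j, ?_, h1, h2.symm⟩
      rcases Nat.eq_zero_or_pos j with rfl | h
      · simp at h2; omega
      · exact h

theorem mem_indexSet_of_eq_one (κ : DComp n) {i : Fin n} (hi : (i : ℕ) = 1) :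
    i ∈ κ.indexSet ↔ κ.InFullPrime ∨
      ∃ j < κ.components.length, κ.offset + (κ.components.take j).sum = 1 := by
  cases κ with
  | below m hm c =>
    simp [indexSet, components, offset, Composition.sizeUpTo, eq_comm, hi, InFullPrime]
  | fullPrime c hc => simp [indexSet, hi, InFullPrime]
  | one c hc | full c hc =>
    simp only [indexSet, components, offset, Composition.sizeUpTo, Set.mem_ofPred_eq,
      Composition.blocks_sum, Nat.sub_self, zero_add, Composition.blocks_length, InFullPrime,
      false_or]
    constructor
    · rintro (h | ⟨j, -, h1, h2⟩)
      · omega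
      · exact ⟨j, h1, by rw [← h2, hi]⟩
    · rintro ⟨j, h1, h2⟩
      refine Or.inr ⟨j, ?_, h1, by rw [h2, hi]⟩
      rcases Nat.eq_zero_or_pos j with rfl | h
      · simp at h2
      · exact h

theorem mem_indexSet_of_eq_zero (κ : DComp n) {i : Fin n} (hi : (i : ℕ) = 0) :
    i ∈ κ.indexSet ↔ ¬ κ.InFullPrime ∧ κ.offset = 0 := by
  cases κ with
  | below m hm c =>
    simp only [indexSet, components, offset, Set.mem_ofPred_eq, hi, InFullPrime,
      Composition.blocks_sum, not_false_eq_true, true_and]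
    constructor
    · rintro ⟨j, -, h⟩
      omega
    · intro h
      omega
  | one c hc | full c hc =>
    simp only [indexSet, components, offset, Set.mem_ofPred_eq, hi, InFullPrime, true_or,
      Composition.blocks_sum, Nat.sub_self, not_false_eq_true, and_self]
  | fullPrime c hc =>
    simp only [indexSet, Set.mem_ofPred_eq, hi, InFullPrime, not_true_eq_false, false_and,
      iff_false, not_or, not_exists, not_and]
    refine ⟨by omega, fun j hj hjl h => ?_⟩
    have h1 := c.monotone_sizeUpTo hj
    have h2 := c.sizeUpTo_strict_mono (i := 0) (by omega)
    simp at h1 h2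
    omega

theorem vec_simple (κ : DComp n) (i : Fin n) : κ.vec (rootLo i) ≤ κ.vec (rootHi i) ∧
    (κ.vec (rootLo i) = κ.vec (rootHi i) ↔ i ∉ κ.indexSet) := by
  have h2n := hn.prop
  rcases Nat.lt_or_ge i 2 with hi | hi
  · have hm := level_mono κ.offset κ.components (show 1 ≤ 2 by omega)
    have hs := @level_succ_eq_iff κ.offset κ.components 1
    have hp1 := @level_pos_iff κ.offset κ.components 1
    have hp2 := @level_pos_iff κ.offset κ.components 2
    rw [show 1 + 1 = 2 from rfl] at hs
    have hd := κ.offset_ne_one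
    rcases Nat.eq_zero_or_pos (i : ℕ) with h0 | h0
    · have e1 : κ.vec (rootLo i) = -(κ.flip 1 * (level κ.offset κ.components 1 : ℤ)) := by
        have := κ.oddVec_vec (-rootLo i)
        rw [neg_neg] at this
        rw [this, κ.vec_of_val one_pos (by simp [rootLo, h0])]
      have e2 : κ.vec (rootHi i) = (level κ.offset κ.components 2 : ℤ) := by
        rw [κ.vec_of_val two_pos (by simp [rootHi, h0]), κ.flip_of_ne_one (by omega), one_mul]
      rw [e1, e2, mem_indexSet_of_eq_zero κ h0]
      by_cases hpr : κ.InFullPrime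
      · rw [hpr.flip_one]
        -- The first component is at least 2, so the coordinates 1 and 2 lie in one block. Negating
        -- the first makes the root `0` vanish on the vector in place of the root `1`.
        have hno : level κ.offset κ.components 1 = level κ.offset κ.components 2 := by
          rw [hs, hpr.offset]
          simp only [zero_add]
          rw [head_eq_one_iff κ.components_pos]
          · exact hpr.head
          · have := κ.offset_add_sum
            rw [hpr.offset] at this
            omega
        rw [hno]
        simp [hpr]
      · rw [flip_of_not hpr]
        refine ⟨by omega, ?_⟩
        simp only [hpr, not_false_eq_true, true_and]
        constructor
        · intro h h'
          have := hp2.2 ⟨components_ne_nil (by omega) h', by omega⟩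
          omega
        · intro h
          have := mt hp2.1 fun h => absurd h.2 (by omega)
          omega
    · have h1 : (i : ℕ) = 1 := by omega
      have e1 : κ.vec (rootLo i) = κ.flip 1 * (level κ.offset κ.components 1 : ℤ) :=
        κ.vec_of_val one_pos (by simp [rootLo, h1])
      have e2 : κ.vec (rootHi i) = (level κ.offset κ.components 2 : ℤ) := by
        rw [κ.vec_of_val two_pos (by simp [rootHi, h1]), κ.flip_of_ne_one (by omega), one_mul]
      rw [e1, e2, mem_indexSet_of_eq_one κ h1]
      by_cases hpr : κ.InFullPrime
      · rw [hpr.flip_one]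
        have := hp2.2 ⟨components_ne_nil (by omega) hpr.offset, by rw [hpr.offset]; omega⟩
        refine ⟨by omega, ?_⟩
        simp only [hpr, true_or, not_true_eq_false, iff_false]
        omega
      · rw [flip_of_not hpr]
        refine ⟨by omega, ?_⟩
        simp only [hpr, false_or, ← hs]
        omega
  · have hm := level_mono κ.offset κ.components (Nat.le_succ i)
    have e1 : κ.vec (rootLo i) = (level κ.offset κ.components i : ℤ) := by
      rw [κ.vec_of_val (x := i) (by omega), κ.flip_of_ne_one (by omega), one_mul]
      simp only [rootLo]
      rw [if_neg (by omega)]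
    have e2 : κ.vec (rootHi i) = (level κ.offset κ.components (i + 1) : ℤ) := by
      rw [κ.vec_of_val (x := i + 1) (by omega), κ.flip_of_ne_one (by omega), one_mul]
      simp only [rootHi]
      rw [if_neg (by omega)]
      push_cast
      rfl
    rw [e1, e2, mem_indexSet_of_two_le κ hi, ← level_succ_eq_iff]
    exact ⟨by exact_mod_cast hm, by norm_cast⟩

theorem dominant_vec (κ : DComp n) : Dominant κ.vec :=
  dominant_of_simple κ.oddVec_vec fun i => (κ.vec_simple i).1

theorem vecType_vec (κ : DComp n) : vecType κ.vec = κ.indexSetᶜ := by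
  ext i
  exact (κ.vec_simple i).2

theorem indexSet_ext {κ : DComp n} {T : Set (Fin n)}
    (h2 : ∀ i : Fin n, 2 ≤ (i : ℕ) →
      (i ∈ T ↔ ∃ j < κ.components.length, κ.offset + (κ.components.take j).sum = i))
    (h1 : ∀ i : Fin n, (i : ℕ) = 1 → (i ∈ T ↔ κ.InFullPrime ∨
      ∃ j < κ.components.length, κ.offset + (κ.components.take j).sum = 1))
    (h0 : ∀ i : Fin n, (i : ℕ) = 0 → (i ∈ T ↔ ¬ κ.InFullPrime ∧ κ.offset = 0)) :
    κ.indexSet = T := by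
  ext i
  rcases Nat.lt_or_ge i 2 with hi | hi
  · rcases Nat.eq_zero_or_pos (i : ℕ) with hi0 | hi0
    · rw [mem_indexSet_of_eq_zero κ hi0, h0 i hi0]
    · rw [mem_indexSet_of_eq_one κ (by omega), h1 i (by omega)]
  · rw [mem_indexSet_of_two_le κ hi, h2 i hi]

/-- Every subset of the generators corresponds to a label. -/
theorem exists_indexSet_eq (T : Set (Fin n)) : ∃ κ : DComp n, κ.indexSet = T := by
  classical
  have h2n := hn.prop
  by_cases h01 : (⟨0, by omega⟩ : Fin n) ∉ T ∧ (⟨1, by omega⟩ : Fin n) ∉ T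
  -- `d` is the least element of `T`, or `n` if `T` is empty; it becomes the offset of a label of
  -- the kind `below`.
  · obtain ⟨d, hdn, hd2, hd3, hd4⟩ : ∃ d ≤ n, 2 ≤ d ∧ (∀ i ∈ T, d ≤ (i : ℕ)) ∧
        (d < n → ∃ i ∈ T, (i : ℕ) = d) := by
      have hT : ∀ i ∈ T, 2 ≤ (i : ℕ) := by
        intro i hi
        by_contra! hc
        rcases Nat.eq_zero_or_pos (i : ℕ) with h | h
        · exact h01.1 (by rwa [show (⟨0, by omega⟩ : Fin n) = i from Fin.ext h.symm])
        · exact h01.2 (by rwa [show (⟨1, by omega⟩ : Fin n) = i from Fin.ext (by simp; omega)])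
      by_cases hne : ∃ x, ∃ i ∈ T, (i : ℕ) = x
      · obtain ⟨i, hi, hi'⟩ := Nat.find_spec hne
        refine ⟨Nat.find hne, by omega, by rw [← hi']; exact hT i hi, fun j hj => ?_,
          fun _ => ⟨i, hi, hi'⟩⟩
        exact Nat.find_min' hne ⟨j, hj, rfl⟩
      · exact ⟨n, le_rfl, h2n, fun i hi => absurd ⟨_, i, hi, rfl⟩ hne, fun h => by omega⟩
    obtain ⟨l, hl1, hl2, hl3⟩ := exists_list_sums (n - d)
      ((Finset.univ.filter fun i : Fin n => i ∈ T).image fun i : Fin n => (i : ℕ) - d)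
      (by
        intro b hb
        obtain ⟨i, hi, rfl⟩ := Finset.mem_image.1 hb
        have := hd3 i (Finset.mem_filter.1 hi).2
        omega)
      (by
        intro h
        obtain ⟨i, hi, hi'⟩ := hd4 (by omega)
        exact Finset.mem_image.2 ⟨i, by simpa using hi, by omega⟩)
    refine ⟨below (n - d) (by omega) ⟨l, fun h => hl1 _ h, hl2⟩, ?_⟩
    ext i
    simp only [indexSet, Composition.sizeUpTo, Set.mem_ofPred_eq]
    have h3 := hl3 (i - d)
    simp only [Finset.mem_image, Finset.mem_filter, Finset.mem_univ, true_and] at h3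
    constructor
    · rintro ⟨j, hj, hij⟩
      obtain ⟨i', hi', hii⟩ := h3.1 ⟨j, hj, by clear h3; omega⟩
      have := hd3 i' hi'
      rwa [show i = i' from Fin.ext (by clear h3; omega)]
    · intro hi
      obtain ⟨j, hj, hij⟩ := h3.2 ⟨i, hi, rfl⟩
      have := hd3 i hi
      exact ⟨j, hj, by clear h3; omega⟩
  -- The index 1 is a block boundary only if 0 lies in `T` as well. If 1 lies in `T` without 0, it
  -- is accounted for by the label being primed.
  · obtain ⟨l, hl1, hl2, hl3⟩ := exists_list_sums n
      (insert 0 ((Finset.univ.filter fun i : Fin n => i ∈ T ∧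
        ((i : ℕ) = 1 → (⟨0, by omega⟩ : Fin n) ∈ T)).image fun i : Fin n => (i : ℕ)))
      (by
        intro b hb
        rcases Finset.mem_insert.1 hb with rfl | hb
        · omega
        · obtain ⟨i, hi, rfl⟩ := Finset.mem_image.1 hb
          exact i.2)
      (fun _ => Finset.mem_insert_self _ _)
    have hl3' : ∀ i : Fin n, 0 < (i : ℕ) → ((∃ j < l.length, (l.take j).sum = i) ↔
        i ∈ T ∧ ((i : ℕ) = 1 → (⟨0, by omega⟩ : Fin n) ∈ T)) := by
      intro i hi
      rw [hl3]
      simp only [Finset.mem_insert, Finset.mem_image, Finset.mem_filter, Finset.mem_univ, true_and]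
      constructor
      · rintro (h | ⟨i', h, h'⟩)
        · omega
        · rwa [show i = i' from Fin.ext h'.symm]
      · exact fun h => Or.inr ⟨i, h, rfl⟩
    have hhead := head_eq_one_iff hl1 (by omega)
    have hh1 := hl3' ⟨1, by omega⟩ (by simp)
    simp only [forall_const] at hh1
    have hne : l.head? ≠ some 1 → ∃ a, 2 ≤ a ∧ l.head? = some a := by
      intro h
      cases l with
      | nil => simp at hl2; omega
      | cons a l =>
        simp only [List.head?_cons, Option.some.injEq, ne_eq] at h ⊢
        have := hl1 a (by simp)
        exact ⟨a, lt_of_le_of_ne this fun e : 1 = a => h e.symm, rfl⟩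
    let c : Composition n := ⟨l, fun h => hl1 _ h, hl2⟩
    by_cases h0 : (⟨0, by omega⟩ : Fin n) ∈ T
    · have hT0 : ∀ i : Fin n, (i : ℕ) = 0 → i ∈ T := fun i hi => by
        rwa [show i = ⟨0, by omega⟩ from Fin.ext hi]
      simp only [h0, and_true, implies_true] at hl3' hh1
      by_cases h1 : (⟨1, by omega⟩ : Fin n) ∈ T
      · refine ⟨one c (hhead.1 (hh1.2 h1)), indexSet_ext ?_ ?_ ?_⟩ <;> intro i hi
        · simp only [components, offset, c, hl2, Nat.sub_self, zero_add]
          exact (hl3' i (by omega)).symm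
        · simp only [components, offset, c, hl2, Nat.sub_self, zero_add, InFullPrime, false_or]
          rw [← hi]
          exact (hl3' i (by omega)).symm
        · simp [components, offset, c, hl2, InFullPrime, hT0 i hi]
      · refine ⟨full c (hne (mt hhead.2 (mt hh1.1 h1))), indexSet_ext ?_ ?_ ?_⟩ <;> intro i hi
        · simp only [components, offset, c, hl2, Nat.sub_self, zero_add]
          exact (hl3' i (by omega)).symm
        · simp only [components, offset, c, hl2, Nat.sub_self, zero_add, InFullPrime, false_or]
          rw [← hi]
          exact (hl3' i (by omega)).symm
        · simp [components, offset, c, hl2, InFullPrime, hT0 i hi]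
    · have h1 : (⟨1, by omega⟩ : Fin n) ∈ T := by tauto
      refine ⟨fullPrime c (hne (mt hhead.2 (mt hh1.1 fun h => h0 h.2))),
        indexSet_ext ?_ ?_ ?_⟩ <;> intro i hi
      · simp only [components, offset, c, hl2, Nat.sub_self, zero_add]
        rw [hl3' i (by omega)]
        exact ⟨fun h => ⟨h, fun h => by omega⟩, fun h => h.1⟩
      · simp only [InFullPrime, true_or, iff_true]
        rwa [show i = ⟨1, by omega⟩ from Fin.ext hi]
      · simp only [InFullPrime, not_true_eq_false, false_and, iff_false]
        rwa [show i = ⟨0, by omega⟩ from Fin.ext hi]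

end DComp

/-! ### Block sizes are invariants -/

theorem List.card_filter_getElem_eq (l : List ℕ) (b : ℕ) :
    (Finset.univ.filter fun j : Fin l.length => l[j.1] = b).card = l.count b := by
  rw [Finset.card_filter, Fin.sum_univ_fun_getElem l fun x => if x = b then 1 else 0]
  induction l with
  | nil => rfl
  | cons a l ih =>
    rw [List.map_cons, List.sum_cons, ih, List.count_cons, add_comm]
    simp

theorem List.Perm.exists_equiv {l l' : List ℕ} (h : l.Perm l') :
    ∃ σ : Fin l.length ≃ Fin l'.length, ∀ j, l'[(σ j).1] = l[j.1] := by
  have h1 : ∀ b, Nonempty ({j : Fin l.length // l[j.1] = b} ≃ {j : Fin l'.length // l'[j.1] = b}) :=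
    fun b => by
      refine Fintype.card_eq.1 ?_
      rw [Fintype.card_subtype, Fintype.card_subtype, List.card_filter_getElem_eq,
        List.card_filter_getElem_eq, h.count_eq]
  exact ⟨Equiv.ofFiberEquiv fun b => (h1 b).some, fun j => Equiv.ofFiberEquiv_map _ j⟩

section
variable {n : ℕ}

/-- Of the points `p` and `-p` of a coordinate with `|v p| = |t|`, exactly one has the value `t`, as
`t ≠ -t`. -/
theorem OddVec.card_filter_eq {v : SignedPoint n → ℤ} (hv : OddVec v) {t : ℤ} (ht : t ≠ 0) :
    (Finset.univ.filter fun p => v p = t).card =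
      ((posPts n).filter fun p => (v p).natAbs = t.natAbs).card := by
  refine Finset.card_bij (fun p _ => absPt p) ?_ ?_ ?_
  · intro p hp
    have hp' := (Finset.mem_filter.1 hp).2
    refine Finset.mem_filter.2 ⟨mem_posPts.2 (absPt_pos p), ?_⟩
    rcases absPt_eq_or p with h | h <;> rw [h]
    · rw [hp']
    · rw [hv, hp', Int.natAbs_neg]
  · intro p hp q hq e
    have hp' := (Finset.mem_filter.1 hp).2
    have hq' := (Finset.mem_filter.1 hq).2
    have hh : ∀ p q : SignedPoint n, v p = t → v q = t → p ≠ -q := by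
      rintro p q h1 h2 rfl
      rw [hv] at h1
      omega
    rcases absPt_eq_or p with h | h <;> rcases absPt_eq_or q with h' | h' <;> rw [h, h'] at e
    · exact e
    · exact absurd e (hh p q hp' hq')
    · exact absurd e.symm (hh q p hq' hp')
    · exact neg_injective e
  · intro p hp
    obtain ⟨h1, h2⟩ := Finset.mem_filter.1 hp
    rw [mem_posPts] at h1
    rcases Int.natAbs_eq_natAbs_iff.1 h2 with h | h
    · exact ⟨p, by simp [h], absPt_of_pos h1⟩
    · exact ⟨-p, by simp [hv p, h], by rw [absPt_neg, absPt_of_pos h1]⟩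

/-- The number of points that lie in blocks of size `b` with a nonzero value. -/
noncomputable def blockCount (v : SignedPoint n → ℤ) (b : ℕ) : ℕ :=
  (Finset.univ.filter fun p => v p ≠ 0 ∧ (Finset.univ.filter fun q => v q = v p).card = b).card

namespace DComp

theorem level_eq_zero_iff (κ : DComp n) {x : ℕ} (hx : x ≤ n) :
    level κ.offset κ.components x = 0 ↔ x ≤ κ.offset := by
  rcases Nat.eq_zero_or_pos x with rfl | h
  · have := @level_pos_iff κ.offset κ.components 0
    simp only [Nat.not_lt_zero, and_false, iff_false, not_lt, Nat.le_zero] at this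
    simp [this]
  · have := κ.vec_eq_zero_iff ⟨x, by omega⟩
    rw [← Int.natAbs_eq_zero, natAbs_vec] at this
    simpa using this

theorem card_posPts_vec_eq (κ : DComp n) {j : ℕ} (hj : j < κ.components.length) :
    ((posPts n).filter fun p => (κ.vec p).natAbs = j + 1).card = κ.components[j] := by
  have hs := κ.offset_add_sum
  have hle : κ.offset + (κ.components.take j).sum + κ.components[j] ≤ n := by
    have h1 := (List.take_sublist (j + 1) κ.components).sum_le_sum fun _ _ => Nat.zero_le _
    rw [List.sum_take_succ _ _ hj] at h1
    omega
  have hioc : (Finset.Ioc (κ.offset + (κ.components.take j).sum)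
      (κ.offset + (κ.components.take j).sum + κ.components[j])).card = κ.components[j] := by
    rw [Nat.card_Ioc]; omega
  rw [← hioc]
  refine Finset.card_bij (fun p _ => p.1.natAbs) ?_ ?_ ?_
  · intro p hp
    obtain ⟨h1, h2⟩ := Finset.mem_filter.1 hp
    rw [natAbs_vec] at h2
    have := p.2
    exact (level_eq_succ_iff hj (by omega)).1 h2
  · intro p hp q hq e
    have h1 := mem_posPts.1 (Finset.mem_filter.1 hp).1
    have h2 := mem_posPts.1 (Finset.mem_filter.1 hq).1
    exact Subtype.ext (by omega)
  · intro x hx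
    have hx' := Finset.mem_Ioc.1 hx
    refine ⟨⟨x, by omega⟩, Finset.mem_filter.2 ⟨mem_posPts.2 (by simp; omega), ?_⟩, by simp⟩
    rw [natAbs_vec]
    exact (level_eq_succ_iff hj (by simp; omega)).2 (by simpa using hx)

theorem exists_level_eq (κ : DComp n) {p : SignedPoint n} (hp : κ.vec p ≠ 0) :
    ∃ j < κ.components.length, (κ.vec p).natAbs = j + 1 := by
  have h1 := level_le_length κ.offset κ.components p.1.natAbs
  rw [← natAbs_vec] at h1
  exact ⟨(κ.vec p).natAbs - 1, by omega, by omega⟩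

theorem card_vec_eq (κ : DComp n) {p : SignedPoint n} {j : ℕ} (hj : j < κ.components.length)
    (h : (κ.vec p).natAbs = j + 1) :
    (Finset.univ.filter fun q => κ.vec q = κ.vec p).card = κ.components[j] := by
  rw [κ.oddVec_vec.card_filter_eq (by omega), h, card_posPts_vec_eq]

theorem card_natAbs_vec_eq (κ : DComp n) {j : ℕ} (hj : j < κ.components.length) :
    (Finset.univ.filter fun p => (κ.vec p).natAbs = j + 1).card = 2 * κ.components[j] := by
  classical
  have h1 : (Finset.univ.filter fun p => (κ.vec p).natAbs = j + 1) =
      (Finset.univ.filter fun p => κ.vec p = ((j + 1 : ℕ) : ℤ)) ∪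
        (Finset.univ.filter fun p => κ.vec p = -((j + 1 : ℕ) : ℤ)) := by
    rw [← Finset.filter_or]
    refine Finset.filter_congr fun p _ => ?_
    exact Int.natAbs_eq_iff
  rw [h1, Finset.card_union_of_disjoint]
  · rw [κ.oddVec_vec.card_filter_eq (by omega), κ.oddVec_vec.card_filter_eq (by omega),
      Int.natAbs_neg, Int.natAbs_natCast, card_posPts_vec_eq κ hj]
    ring
  · rw [Finset.disjoint_filter]
    intro p _ h2 h3
    omega

/-- Each component equal to `b` accounts for `2b` signed points: `b` with the value of the block and
`b` with its negative. -/
theorem blockCount_vec (κ : DComp n) (b : ℕ) :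
    blockCount κ.vec b = κ.components.count b * (2 * b) := by
  unfold blockCount
  rw [Finset.card_eq_sum_card_fiberwise (f := fun p => (κ.vec p).natAbs - 1)
    (t := Finset.range κ.components.length), Finset.sum_range, ← List.card_filter_getElem_eq,
    ← smul_eq_mul, ← Finset.sum_const, Finset.sum_filter]
  · refine Finset.sum_congr rfl fun j _ => ?_
    rw [Finset.filter_filter]
    split_ifs with h
    · rw [← h, ← card_natAbs_vec_eq κ j.2]
      congr 1
      refine Finset.filter_congr fun p _ => ?_
      constructor
      · rintro ⟨⟨h1, -⟩, h2⟩
        omega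
      · intro h1
        exact ⟨⟨by omega, card_vec_eq κ j.2 h1⟩, by omega⟩
    · rw [Finset.card_eq_zero, Finset.filter_eq_empty_iff]
      rintro p - ⟨⟨h1, h2⟩, h3⟩
      rw [card_vec_eq κ j.2 (by omega)] at h2
      exact h h2
  · intro p hp
    obtain ⟨j, hj, h⟩ := κ.exists_level_eq (Finset.mem_filter.1 hp).2.1
    simp only [Finset.coe_range, Set.mem_Iio]
    omega

theorem exists_vec_eq_zero (κ : DComp n) {p : SignedPoint n} (hp : κ.vec p = 0) :
    ∃ q, q ≠ p ∧ q ≠ -p ∧ κ.vec q = 0 := by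
  have h1 := κ.offset_ne_one
  have h2 := κ.sum_components_le
  have h3 := κ.offset_add_sum
  have hp' := p.2
  simp only [vec_eq_zero_iff] at *
  refine ⟨⟨if p.1.natAbs = 1 then 2 else 1, by split_ifs <;> omega⟩, ?_, ?_, ?_⟩
  · rw [Ne, Subtype.ext_iff]
    split_ifs <;> dsimp only <;> omega
  · rw [Ne, Subtype.ext_iff, val_neg]
    split_ifs <;> dsimp only <;> omega
  · split_ifs
    · simp; omega
    · simp; omega

end DComp

/-- A second zero coordinate `q` makes the roots of `(p, q)` and `(p, -q)` both vanish, so `u p = u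
q = -u p`. This is how vanishing of a coordinate is seen by roots of type D. -/
theorem eq_zero_of_zeroSet_eq {v u : SignedPoint n → ℤ} (hv : OddVec v) (hu : OddVec u)
    (hz : ∀ p, v p = 0 → ∃ q, q ≠ p ∧ q ≠ -p ∧ v q = 0) (h : zeroSet v ⊆ zeroSet u)
    {p : SignedPoint n} (hp : v p = 0) : u p = 0 := by
  obtain ⟨q, h1, h2, h3⟩ := hz p hp
  rw [zeroSet_subset_iff] at h
  have h4 := h p q h2 (by rw [hp, h3])
  have h5 := h p (-q) (fun e => h1 (neg_injective e)) (by rw [hv, hp, h3]; rfl)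
  rw [hu] at h5
  omega

/-- Where the vectors are nonzero, `p` and `-p` never have equal values, so the fibres are
determined by the vanishing roots alone. -/
theorem blockCount_congr {v u : SignedPoint n → ℤ} (hv : OddVec v) (hu : OddVec u)
    (hzv : ∀ p, v p = 0 → ∃ q, q ≠ p ∧ q ≠ -p ∧ v q = 0)
    (hzu : ∀ p, u p = 0 → ∃ q, q ≠ p ∧ q ≠ -p ∧ u q = 0) (h : zeroSet v = zeroSet u) (b : ℕ) :
    blockCount v b = blockCount u b := by
  have h0 : ∀ p, v p = 0 ↔ u p = 0 := fun p =>
    ⟨eq_zero_of_zeroSet_eq hv hu hzv h.subset, eq_zero_of_zeroSet_eq hu hv hzu h.superset⟩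
  unfold blockCount
  congr 1
  refine Finset.filter_congr fun p _ => ?_
  rw [Ne, Ne, h0 p]
  refine and_congr_right fun hp => ?_
  rw [Finset.filter_congr (s := Finset.univ) (p := fun q => v q = v p) (q := fun q => u q = u p)]
  intro q _
  by_cases hq : q = -p
  · have hp' := mt (h0 p).1 hp
    rw [hq, hv, hu]
    constructor <;> intro e <;> omega
  · constructor <;> intro e
    · exact (zeroSet_subset_iff.1 h.subset p q hq e.symm).symm
    · exact (zeroSet_subset_iff.1 h.superset p q hq e.symm).symm

variable [hn : n.AtLeastTwo]

theorem blockCount_pull (v : SignedPoint n → ℤ) (g : DGroup n) (b : ℕ) :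
    blockCount (pull v g) b = blockCount v b := by
  have h1 : ∀ t, (Finset.univ.filter fun q => pull v g q = t).card =
      (Finset.univ.filter fun q => v q = t).card := fun t => by
    rw [Finset.card_filter, Finset.card_filter]
    exact Equiv.sum_comp g.1 fun q => if v q = t then 1 else 0
  unfold blockCount
  rw [Finset.card_filter, Finset.card_filter, ← Equiv.sum_comp g.1 fun p =>
    if v p ≠ 0 ∧ (Finset.univ.filter fun q => v q = v p).card = b then 1 else 0]
  exact Finset.sum_congr rfl fun p _ => if_congr (by rw [h1]; rfl) rfl rfl

/-! ### Conjugate zero sets have equivalent labels. -/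

/-- The zero sets of the vectors are conjugate. -/
def ZeroConj (v u : SignedPoint n → ℤ) : Prop := ∃ g : DGroup n, zeroSet v = zeroSet (pull u g)

theorem ZeroConj.symm {v u : SignedPoint n → ℤ} (h : ZeroConj v u) : ZeroConj u v := by
  obtain ⟨g, hg⟩ := h
  refine ⟨g⁻¹, ?_⟩
  apply subset_antisymm
  · rw [← zeroSet_pull_subset_iff g, pull_pull, inv_mul_cancel, pull_one, hg]
  · rw [← zeroSet_pull_subset_iff g, pull_pull, inv_mul_cancel, pull_one, hg]

theorem ZeroConj.trans {v u w : SignedPoint n → ℤ} (h : ZeroConj v u) (h' : ZeroConj u w) :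
    ZeroConj v w := by
  obtain ⟨g, hg⟩ := h
  obtain ⟨g', hg'⟩ := h'
  refine ⟨g' * g, hg.trans ?_⟩
  rw [← pull_pull]
  exact subset_antisymm ((zeroSet_pull_subset_iff g).2 hg'.subset)
    ((zeroSet_pull_subset_iff g).2 hg'.superset)

namespace DComp

theorem perm_of_zeroConj {κ ν : DComp n} (h : ZeroConj κ.vec ν.vec) :
    κ.components.Perm ν.components := by
  obtain ⟨g, hg⟩ := h
  rw [List.perm_iff_count]
  intro b
  rcases Nat.eq_zero_or_pos b with rfl | hb
  · rw [List.count_eq_zero_of_not_mem fun h => lt_irrefl _ (κ.components_pos 0 h),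
      List.count_eq_zero_of_not_mem fun h => lt_irrefl _ (ν.components_pos 0 h)]
  · have h1 := blockCount_congr κ.oddVec_vec (ν.oddVec_vec.pull g)
      (fun p => κ.exists_vec_eq_zero) (fun p hp => ?_) hg b
    · rw [blockCount_pull, blockCount_vec, blockCount_vec] at h1
      exact Nat.eq_of_mul_eq_mul_right (by omega) h1
    · obtain ⟨q, h2, h3, h4⟩ := ν.exists_vec_eq_zero hp
      refine ⟨(g⁻¹).1 q, ?_, ?_, by simpa [pull_apply] using h4⟩
      · rintro rfl
        simp at h2
      · intro e
        rw [← neg_eq_iff_eq_neg, ← coe_apply_neg] at e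
        apply h3
        have h5 : g.1 p = -q := by rw [← e]; simp
        rw [h5, neg_neg]

theorem signProd_vec_fullPrime {ν : DComp n} (h : ν.InFullPrime) : signProd ν.vec = -1 := by
  have h2n := hn.prop
  unfold signProd
  rw [Finset.prod_eq_single (⟨1, by omega⟩ : SignedPoint n)]
  · rw [ν.vec_of_val one_pos (by simp), h.flip_one]
    have := ν.level_eq_zero_iff (x := 1) (by omega)
    rw [h.offset] at this ⊢
    apply Int.sign_eq_neg_one_of_neg
    omega
  · intro p hp hp1
    have hp' := p.2
    rw [mem_posPts] at hp
    rw [Ne, Subtype.ext_iff] at hp1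
    simp only at hp1
    rw [ν.vec_of_val (x := p.1.toNat) (by omega) (by omega), ν.flip_of_ne_one (by omega)]
    have := ν.level_eq_zero_iff (x := p.1.toNat) (by omega)
    rw [h.offset] at this ⊢
    apply Int.sign_eq_one_of_pos
    omega
  · intro h; exact absurd (mem_posPts.2 (by simp)) h

/-- The containment makes `u` constant on each block of `κ`, so the sign product is a product of
even powers of signs. -/
theorem signProd_eq_one_of_even {κ : DComp n} (hκ : κ.InFull)
    (he : ∀ a ∈ κ.components, Even a) {u : SignedPoint n → ℤ} (hu : ∀ p, u p ≠ 0)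
    (h : zeroSet κ.vec ⊆ zeroSet u) : signProd u = 1 := by
  classical
  have hnp : ¬ κ.InFullPrime := by cases κ <;> simp_all [InFull, InFullPrime]
  have hoff : κ.offset = 0 := by
    cases κ <;> simp_all [InFull, components, DComp.offset]
  rw [zeroSet_subset_iff] at h
  unfold signProd
  rw [← Finset.prod_fiberwise_of_maps_to (g := κ.vec) (t := (posPts n).image κ.vec)
    fun p hp => Finset.mem_image_of_mem _ hp]
  refine Finset.prod_eq_one fun t ht => ?_
  obtain ⟨p, hp, rfl⟩ := Finset.mem_image.1 ht
  have hv0 : ∀ q, κ.vec q ≠ 0 := fun q e => by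
    have := q.2
    rw [vec_eq_zero_iff] at e
    omega
  have hpos : ∀ q ∈ posPts n, 0 ≤ κ.vec q := by
    intro q hq
    rw [mem_posPts] at hq
    rw [κ.vec_of_val (x := q.1.toNat) (by omega) (by omega), flip_of_not hnp]
    omega
  have hconst : ∀ q ∈ (posPts n).filter fun q => κ.vec q = κ.vec p, (u q).sign = (u p).sign := by
    intro q hq
    obtain ⟨h1, h2⟩ := Finset.mem_filter.1 hq
    rw [h q p _ h2]
    rintro rfl
    rw [mem_posPts] at h1 hp
    simp only [val_neg] at hp
    omega
  rw [Finset.prod_congr rfl hconst, Finset.prod_const]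
  have hcard : Even ((posPts n).filter fun q => κ.vec q = κ.vec p).card := by
    obtain ⟨j, hj, hj'⟩ := κ.exists_level_eq (hv0 p)
    have : ((posPts n).filter fun q => κ.vec q = κ.vec p) =
        (posPts n).filter fun q => (κ.vec q).natAbs = j + 1 := by
      refine Finset.filter_congr fun q hq => ?_
      have h1 := hpos q hq
      have h2 := hpos p hp
      constructor <;> intro e <;> omega
    rw [this, card_posPts_vec_eq κ hj]
    exact he _ (List.getElem_mem _)
  rcases lt_or_gt_of_ne (hu p) with h1 | h1
  · rw [Int.sign_eq_neg_one_of_neg h1, hcard.neg_one_pow]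
  · rw [Int.sign_eq_one_of_pos h1, one_pow]

/-- The group preserves the sign product. It is `-1` for a primed label, where the first coordinate
alone is negative, but conjugacy to `κ` would make it `1`. -/
theorem not_zeroConj_of_even {κ ν : DComp n} (hκ : κ.InFull) (hν : ν.InFullPrime)
    (he : ∀ a ∈ κ.components, Even a) : ¬ ZeroConj κ.vec ν.vec := by
  rintro ⟨g, hg⟩
  have h1 := signProd_eq_one_of_even hκ he (u := pull ν.vec g) (fun p e => ?_) hg.subset
  · rw [signProd_pull g ν.oddVec_vec, signProd_vec_fullPrime hν] at h1
    omega
  · rw [pull_apply, vec_eq_zero_iff, hν.offset] at e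
    have := (g.1 p).2
    omega

theorem equivalent_of_zeroConj {κ ν : DComp n} (h : ZeroConj κ.vec ν.vec) : κ.Equivalent ν := by
  have hp := perm_of_zeroConj h
  refine ⟨hp, ?_, ?_⟩
  · rintro ⟨h1, h2, h3⟩
    exact not_zeroConj_of_even h1 h2 h3 h
  · rintro ⟨h1, h2, h3⟩
    exact not_zeroConj_of_even h2 h1 (fun a ha => h3 a (hp.mem_iff.2 ha)) h.symm

end DComp

end

/-! ### Construction of signed permutations -/

section
variable {n : ℕ}

/-- A signed point is a sign and a coordinate. -/
def signedEquiv (n : ℕ) : ℤˣ × Fin n ≃ SignedPoint n where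
  toFun x := ⟨x.1 * ((x.2 : ℤ) + 1), by
    have := x.2.2
    rcases Int.units_eq_one_or x.1 with h | h <;> rw [h] <;> simp <;> omega⟩
  invFun p := (if 0 < p.1 then 1 else -1, ⟨p.1.natAbs - 1, by have := p.2; omega⟩)
  left_inv := by
    rintro ⟨s, i⟩
    rcases Int.units_eq_one_or s with rfl | rfl
    · simp only [Units.val_one, one_mul, Prod.mk.injEq, Fin.ext_iff]
      exact ⟨if_pos (by omega), by omega⟩
    · simp only [Units.val_neg, Units.val_one, Prod.mk.injEq, Fin.ext_iff]
      exact ⟨if_neg (by omega), by omega⟩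
  right_inv p := by
    have := p.2
    apply Subtype.ext
    dsimp only
    split_ifs
    · simp only [Units.val_one]; omega
    · simp only [Units.val_neg, Units.val_one]; omega

theorem signedEquiv_val (x : ℤˣ × Fin n) : (signedEquiv n x).1 = x.1 * ((x.2 : ℤ) + 1) := rfl

theorem neg_signedEquiv (s : ℤˣ) (i : Fin n) : -signedEquiv n (s, i) = signedEquiv n (-s, i) :=
  Subtype.ext (by simp [signedEquiv_val])

theorem natAbs_signedEquiv (s : ℤˣ) (i : Fin n) : (signedEquiv n (s, i)).1.natAbs = i + 1 := by
  rw [signedEquiv_val]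
  rcases Int.units_eq_one_or s with rfl | rfl
  · simp only [Units.val_one]; omega
  · simp only [Units.val_neg, Units.val_one]; omega

theorem sign_signedEquiv (s : ℤˣ) (i : Fin n) : (signedEquiv n (s, i)).1.sign = s := by
  rw [signedEquiv_val]
  rcases Int.units_eq_one_or s with rfl | rfl
  · rw [Int.sign_eq_one_of_pos]
    · simp
    · simp only [Units.val_one]; omega
  · rw [Int.sign_eq_neg_one_of_neg]
    · simp
    · simp only [Units.val_neg, Units.val_one]; omega

theorem prod_posPts {M : Type*} [CommMonoid M] (f : SignedPoint n → M) :
    ∏ p ∈ posPts n, f p = ∏ i : Fin n, f (signedEquiv n (1, i)) := by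
  symm
  refine Finset.prod_bij (fun i _ => signedEquiv n (1, i)) ?_ ?_ ?_ ?_
  · intro i _
    rw [mem_posPts, signedEquiv_val]
    simp only [Units.val_one]
    omega
  · intro i _ j _ h
    simpa using h
  · intro p hp
    rw [mem_posPts] at hp
    have := p.2
    refine ⟨⟨p.1.natAbs - 1, by omega⟩, Finset.mem_univ _, Subtype.ext ?_⟩
    rw [signedEquiv_val]
    simp only [Units.val_one]
    omega
  · exact fun _ _ => rfl

/-- The signed permutation that permutes the coordinates by `π` and multiplies them by `ε`. -/
def signedPerm (π : Equiv.Perm (Fin n)) (ε : Fin n → ℤˣ) : Equiv.Perm (SignedPoint n) :=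
  ((signedEquiv n).symm.trans
    { toFun := fun x => (x.1 * ε x.2, π x.2)
      invFun := fun x => (x.1 * (ε (π.symm x.2))⁻¹, π.symm x.2)
      left_inv := fun x => by simp [mul_assoc, Int.units_mul_self]
      right_inv := fun x => by simp [mul_assoc, Int.units_mul_self] }).trans (signedEquiv n)

theorem signedPerm_apply (π : Equiv.Perm (Fin n)) (ε : Fin n → ℤˣ) (s : ℤˣ) (i : Fin n) :
    signedPerm π ε (signedEquiv n (s, i)) = signedEquiv n (s * ε i, π i) := by
  simp [signedPerm]

theorem signedPerm_neg (π : Equiv.Perm (Fin n)) (ε : Fin n → ℤˣ) (p : SignedPoint n) :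
    signedPerm π ε (-p) = -signedPerm π ε p := by
  obtain ⟨⟨s, i⟩, rfl⟩ := (signedEquiv n).surjective p
  rw [neg_signedEquiv, signedPerm_apply, signedPerm_apply, neg_signedEquiv, neg_mul]

theorem signProd_signedPerm (π : Equiv.Perm (Fin n)) (ε : Fin n → ℤˣ) :
    signProd (fun p => (signedPerm π ε p).1) = ((∏ i, ε i : ℤˣ) : ℤ) := by
  unfold signProd
  rw [prod_posPts]
  simp only [signedPerm_apply, sign_signedEquiv, one_mul]
  push_cast
  rfl

theorem zeroSet_eq_of_injOn {v u : SignedPoint n → ℤ} (T : ℤ → ℤ)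
    (hT : Set.InjOn T (Set.range v)) (h : ∀ p, u p = T (v p)) : zeroSet v = zeroSet u := by
  ext x
  rw [mem_zeroSet, mem_zeroSet, h, h, hT.eq_iff ⟨_, rfl⟩ ⟨_, rfl⟩]

namespace DComp

/-- The number of the block that contains a coordinate. -/
def coordLevel (κ : DComp n) (i : Fin n) : ℕ := level κ.offset κ.components (i + 1)

/-- The signs of the coordinates of the vector of a label, as units. -/
noncomputable def unitFlip (κ : DComp n) (i : Fin n) : ℤˣ := if κ.flip (i + 1) = 1 then 1 else -1

theorem coe_unitFlip (κ : DComp n) (i : Fin n) : (κ.unitFlip i : ℤ) = κ.flip (i + 1) := by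
  unfold unitFlip
  rcases κ.flip_eq_or (i + 1) with h | h <;> simp [h]

theorem vec_signedEquiv (κ : DComp n) (s : ℤˣ) (i : Fin n) :
    κ.vec (signedEquiv n (s, i)) = κ.unitFlip i * s * κ.coordLevel i := by
  rw [vec, natAbs_signedEquiv, sign_signedEquiv, coe_unitFlip, coordLevel]

theorem coordLevel_le (κ : DComp n) (i : Fin n) : κ.coordLevel i ≤ κ.components.length :=
  level_le_length _ _ _

theorem card_coordLevel_eq (κ : DComp n) {j : ℕ} (hj : j < κ.components.length) :
    (Finset.univ.filter fun i => κ.coordLevel i = j + 1).card = κ.components[j] := by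
  rw [← κ.card_posPts_vec_eq hj]
  -- The cardinalities are compared as exponents of 2, which turns them into products to which
  -- `prod_posPts` applies.
  apply Nat.pow_right_injective le_rfl
  dsimp only
  rw [← Finset.prod_const, ← Finset.prod_const, Finset.prod_filter, Finset.prod_filter,
    prod_posPts]
  simp only [natAbs_vec, natAbs_signedEquiv, coordLevel]
  rfl

theorem card_coordLevel_eq_zero (κ : DComp n) :
    (Finset.univ.filter fun i => κ.coordLevel i = 0).card = κ.offset := by
  have h1 : (Finset.univ.filter fun i => κ.coordLevel i = 0) =
      Finset.univ.filter fun i : Fin n => (i : ℕ) < κ.offset := by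
    refine Finset.filter_congr fun i _ => ?_
    rw [coordLevel, level_eq_zero_iff κ (by omega)]
    omega
  have := κ.offset_add_sum
  rw [h1, Fin.card_filter_val_lt, min_eq_right (by omega)]

theorem prod_unitFlip (κ : DComp n) (hn : 0 < n) [Decidable κ.InFullPrime] :
    ∏ i, κ.unitFlip i = if κ.InFullPrime then -1 else 1 := by
  rw [Finset.prod_eq_single ⟨0, hn⟩]
  · unfold unitFlip
    split_ifs with h1 h2 h2
    · rw [zero_add, h2.flip_one] at h1
      omega
    · rfl
    · rfl
    · exact absurd (flip_of_not h2 _) h1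
  · intro i _ hi
    rw [unitFlip, if_pos]
    apply κ.flip_of_ne_one
    intro h
    exact hi (Fin.ext (by simpa using h))
  · intro h; exact absurd (Finset.mem_univ _) h

/-- A bijection of the blocks, and a permutation of the coordinates that realizes it. -/
theorem exists_coord_perm {κ ν : DComp n} (h : κ.components.Perm ν.components) :
    ∃ (τ : ℕ → ℕ) (π : Equiv.Perm (Fin n)), Set.InjOn τ (Set.Iic κ.components.length) ∧ τ 0 = 0 ∧
      ∀ i, ν.coordLevel (π i) = τ (κ.coordLevel i) := by
  obtain ⟨σ, hσ⟩ := h.exists_equiv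
  -- Blocks are numbered from 1 in levels and from 0 in lists, hence the shifts; level 0, the zero
  -- coordinates, is sent to itself.
  let τ : ℕ → ℕ := fun t => if ht : 0 < t ∧ t - 1 < κ.components.length then
    (σ ⟨t - 1, ht.2⟩ : ℕ) + 1 else 0
  have hτ0 : τ 0 = 0 := dif_neg (by simp)
  have hτ : ∀ j : Fin κ.components.length, τ (j + 1) = σ j + 1 := fun j =>
    (dif_pos ⟨by omega, by simp⟩).trans (by simp)
  have hτinj : Set.InjOn τ (Set.Iic κ.components.length) := by
    intro a ha b hb hab
    rw [Set.mem_Iic] at ha hb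
    cases a with
    | zero =>
      cases b with
      | zero => rfl
      | succ b => rw [hτ0, hτ ⟨b, hb⟩] at hab; omega
    | succ a =>
      cases b with
      | zero => rw [hτ0, hτ ⟨a, ha⟩] at hab; omega
      | succ b =>
        rw [hτ ⟨a, ha⟩, hτ ⟨b, hb⟩] at hab
        have := σ.injective (Fin.ext (by omega : (σ ⟨a, ha⟩ : ℕ) = σ ⟨b, hb⟩))
        rw [Fin.mk.injEq] at this
        omega
  have hoff : κ.offset = ν.offset := by rw [offset, offset, h.sum_eq]
  -- Matching blocks have equal sizes, so bijections between the fibres exist and glue to the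
  -- permutation `π`.
  have hfib : ∀ t, Nonempty ({i // τ (κ.coordLevel i) = t} ≃ {i // ν.coordLevel i = t}) := by
    intro t
    refine Fintype.card_eq.1 ?_
    rw [Fintype.card_subtype, Fintype.card_subtype]
    cases t with
    | zero =>
      rw [card_coordLevel_eq_zero, ← hoff, ← card_coordLevel_eq_zero]
      congr 1
      refine Finset.filter_congr fun i _ => ?_
      conv_lhs => rw [← hτ0]
      exact hτinj.eq_iff (κ.coordLevel_le i) (Nat.zero_le _)
    | succ j' =>
      by_cases hj' : j' < ν.components.length
      · obtain ⟨j, hj⟩ := σ.surjective ⟨j', hj'⟩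
        have h1 := hσ j
        rw [card_coordLevel_eq ν hj']
        simp only [hj] at h1
        rw [h1, ← card_coordLevel_eq κ j.2]
        congr 1
        refine Finset.filter_congr fun i _ => ?_
        have h2 : j' + 1 = τ (j + 1) := by rw [hτ, hj]
        rw [h2]
        exact hτinj.eq_iff (κ.coordLevel_le i) j.2
      · rw [Finset.filter_eq_empty_iff.2, Finset.filter_eq_empty_iff.2]
        · intro i _ hi
          have := ν.coordLevel_le i
          omega
        · intro i _ hi
          have hle := κ.coordLevel_le i
          cases hc : κ.coordLevel i with
          | zero => rw [hc, hτ0] at hi; omega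
          | succ j =>
            rw [hc] at hi hle
            rw [hτ ⟨j, hle⟩] at hi
            have := (σ ⟨j, hle⟩).2
            omega
  exact ⟨τ, Equiv.ofFiberEquiv fun t => (hfib t).some, hτinj, hτ0,
    fun i => Equiv.ofFiberEquiv_map _ i⟩

/-- Signs for the blocks that correct the parity. -/
theorem exists_block_signs {κ ν : DComp n} (hn : 0 < n) (h : κ.Equivalent ν) :
    ∃ θ : ℕ → ℤˣ, ∏ i, θ (κ.coordLevel i) = (∏ i, κ.unitFlip i) * ∏ i, ν.unitFlip i := by
  classical
  rw [prod_unitFlip κ hn, prod_unitFlip ν hn]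
  by_cases hp : κ.InFullPrime ↔ ν.InFullPrime
  · refine ⟨fun _ => 1, ?_⟩
    by_cases hκ : κ.InFullPrime
    · simp [hκ, hp.1 hκ]
    · simp [hκ, mt hp.2 hκ]
  -- Exactly one label is primed, so the offsets are 0. If all components were even, neither label
  -- could begin with 1, which leaves the case excluded from `≈`. Changing the sign of an odd block
  -- then supplies the missing factor `-1`.
  · have hodd : ∃ j, ∃ hj : j < κ.components.length, Odd κ.components[j] := by
      by_contra! hc
      have he : ∀ a ∈ κ.components, Even a := by
        intro a ha
        obtain ⟨j, hj, rfl⟩ := List.getElem_of_mem ha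
        exact Nat.not_odd_iff_even.1 (hc j hj)
      obtain ⟨h1, h2, h3⟩ := h
      have he' : ∀ a ∈ ν.components, Even a := fun a ha => he a (h1.mem_iff.2 ha)
      have key : ∀ κ : DComp n, κ.offset = 0 → (∀ a ∈ κ.components, Even a) →
          κ.InFull ∨ κ.InFullPrime := by
        intro κ hoff he
        cases κ with
        | below m hm c =>
          simp only [offset, components, Composition.blocks_sum] at hoff
          omega
        | one c hc =>
          exact absurd (he 1 (List.mem_of_mem_head? (by simp [components, hc]))) (by decide)
        | full c hc => exact Or.inl trivial
        | fullPrime c hc => exact Or.inr trivial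
      have hoff : κ.offset = ν.offset := by rw [offset, offset, h1.sum_eq]
      by_cases hκ : κ.InFullPrime
      · have hν : ¬ ν.InFullPrime := fun h => hp (iff_of_true hκ h)
        exact h3 ⟨hκ, (key ν (hoff ▸ hκ.offset) he').resolve_right hν, he⟩
      · have hν : ν.InFullPrime := by
          by_contra h
          exact hp (iff_of_false hκ h)
        exact h2 ⟨(key κ (hoff.trans hν.offset) he).resolve_right hκ, hν, he⟩
    obtain ⟨j, hj, hodd⟩ := hodd
    refine ⟨fun t => if t = j + 1 then -1 else 1, ?_⟩
    have hr : ((if κ.InFullPrime then -1 else 1) * (if ν.InFullPrime then -1 else 1) : ℤˣ) =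
        -1 := by
      by_cases hκ : κ.InFullPrime <;> by_cases hν : ν.InFullPrime <;> simp_all
    rw [hr, Finset.prod_ite, Finset.prod_const_one, mul_one, Finset.prod_const,
      card_coordLevel_eq κ hj, hodd.neg_one_pow]

variable [hn : n.AtLeastTwo]

theorem zeroConj_of_equivalent {κ ν : DComp n} (h : κ.Equivalent ν) :
    ZeroConj κ.vec ν.vec := by
  have h2n := hn.prop
  obtain ⟨τ, π, hτ, hτ0, hπ⟩ := exists_coord_perm h.1
  obtain ⟨θ, hθ⟩ := exists_block_signs (by omega) h
  -- These signs undo the flips of both labels and multiply whole blocks by `θ`. By the choice of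
  -- `θ` their product is a square in `ℤˣ`, hence 1.
  let ε : Fin n → ℤˣ := fun i => ν.unitFlip (π i) * κ.unitFlip i * θ (κ.coordLevel i)
  have hmem : signedPerm π ε ∈ DGroup n := by
    refine mem_DGroup_of_signProd (signedPerm_neg π ε) ?_
    rw [signProd_signedPerm]
    simp only [ε, Finset.prod_mul_distrib]
    rw [hθ, Equiv.prod_comp π ν.unitFlip,
      mul_comm (∏ i, κ.unitFlip i), Int.units_mul_self]
    rfl
  -- The translated vector of `ν` arises from that of `κ` by relabelling values: `τ` renumbers the
  -- blocks and `θ` changes their signs. The relabelling is injective, so the same roots vanish.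
  refine ⟨⟨_, hmem⟩, zeroSet_eq_of_injOn
    (fun z => z.sign * (θ z.natAbs : ℤ) * (τ z.natAbs : ℤ)) ?_ ?_⟩
  · have hθ1 : ∀ t, (θ t : ℤ).natAbs = 1 := fun t => Int.units_natAbs _
    have hpos : ∀ p, κ.vec p ≠ 0 → 0 < τ (κ.vec p).natAbs := by
      intro p hp
      rw [Nat.pos_iff_ne_zero, ← hτ0]
      intro e
      have := hτ (by rw [Set.mem_Iic, natAbs_vec]; exact level_le_length _ _ _)
        (Nat.zero_le _) e
      omega
    have habs : ∀ p, (((κ.vec p).sign * (θ (κ.vec p).natAbs : ℤ) *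
        (τ (κ.vec p).natAbs : ℤ) : ℤ)).natAbs = τ (κ.vec p).natAbs := by
      intro p
      by_cases hp : κ.vec p = 0
      · simp [hp, hτ0]
      · rw [Int.natAbs_mul, Int.natAbs_mul, Int.natAbs_sign_of_ne_zero hp, hθ1]
        simp
    rintro _ ⟨p, rfl⟩ _ ⟨q, rfl⟩ e
    simp only at e
    have h1 : (κ.vec p).natAbs = (κ.vec q).natAbs := by
      have h2 := congrArg Int.natAbs e
      rw [habs, habs] at h2
      exact hτ (by rw [Set.mem_Iic, natAbs_vec]; exact level_le_length _ _ _)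
        (by rw [Set.mem_Iic, natAbs_vec]; exact level_le_length _ _ _) h2
    by_cases hp : κ.vec p = 0
    · omega
    · have h2 := hpos p hp
      rw [← h1] at e
      have h3 := mul_right_cancel₀ (by omega) e
      have h4 := mul_right_cancel₀ (Units.ne_zero _) h3
      rw [← Int.sign_mul_natAbs (κ.vec p), ← Int.sign_mul_natAbs (κ.vec q), h4, h1]
  · intro p
    obtain ⟨⟨s, i⟩, rfl⟩ := (signedEquiv n).surjective p
    rw [pull_apply]
    change ν.vec (signedPerm π ε (signedEquiv n (s, i))) = _
    have h1 : (κ.vec (signedEquiv n (s, i))).natAbs = κ.coordLevel i := by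
      rw [natAbs_vec, natAbs_signedEquiv, coordLevel]
    rw [signedPerm_apply, vec_signedEquiv, h1, hπ]
    by_cases h0 : κ.coordLevel i = 0
    · rw [h0, hτ0]
      simp
    · have h2 : (κ.vec (signedEquiv n (s, i))).sign = κ.unitFlip i * s := by
        have hu : ∀ a : ℤˣ, (a : ℤ).sign = a := fun a => by
          rcases Int.units_eq_one_or a with rfl | rfl <;> rfl
        rw [vec_signedEquiv, Int.sign_mul, Int.sign_mul, hu, hu,
          Int.sign_eq_one_of_pos (by omega), mul_one]
      rw [h2]
      congr 1
      simp only [ε, Units.val_mul]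
      have h3 : (ν.unitFlip (π i) : ℤ) * ν.unitFlip (π i) = 1 := by
        rw [← Units.val_mul, Int.units_mul_self]
        rfl
      linear_combination (s * κ.unitFlip i * θ (κ.coordLevel i) : ℤ) * h3

theorem zeroConj_iff {κ ν : DComp n} : ZeroConj κ.vec ν.vec ↔ κ.Equivalent ν :=
  ⟨equivalent_of_zeroConj, zeroConj_of_equivalent⟩

end DComp

end

/-! ### The radical of an algebra with triangular left multiplication -/

section
variable {k A ι : Type*} [Field k] [Ring A] [Algebra k A]

/-- The part of a filtration by the rank of basis elements. -/
def rankSpan (k : Type*) [Field k] {A ι : Type*} [AddCommGroup A] [Module k A] (b : ι → A)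
    (r : ι → ℕ) (m : ℕ) : Submodule k A :=
  Submodule.span k (b '' {l | r l < m})

theorem rankSpan_mono (b : ι → A) (r : ι → ℕ) : Monotone (rankSpan k b r) := fun _ _ h =>
  Submodule.span_mono (Set.image_mono fun _ hl => lt_of_lt_of_le hl h)

variable (b : Module.Basis ι k A) {r : ι → ℕ} {c : ι → ι → k}

/-- The diagonal coefficients of left multiplication. -/
noncomputable def diagCoeff (c : ι → ι → k) (j : ι) : A →ₗ[k] k := b.constr k fun i => c i j

variable {b}

theorem mul_basis_sub_mem
    (hmul : ∀ i j, b i * b j - c i j • b j ∈ rankSpan k b r (r j)) (a : A) (j : ι) :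
    a * b j - diagCoeff b c j a • b j ∈ rankSpan k b r (r j) := by
  have ha : a ∈ Submodule.span k (Set.range b) := b.span_eq ▸ Submodule.mem_top
  induction ha using Submodule.span_induction with
  | mem x hx =>
    obtain ⟨i, rfl⟩ := hx
    rw [diagCoeff, b.constr_basis]
    exact hmul i j
  | zero => simp
  | add x y _ _ hx hy =>
    convert add_mem hx hy using 1
    rw [map_add, add_mul, add_smul]
    abel
  | smul t x _ hx =>
    convert Submodule.smul_mem _ t hx using 1
    rw [map_smul, smul_mul_assoc, smul_sub, smul_smul, smul_eq_mul]

theorem mul_mem_rankSpan (hmul : ∀ i j, b i * b j - c i j • b j ∈ rankSpan k b r (r j)) (a : A)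
    {x : A} {m : ℕ} (hx : x ∈ rankSpan k b r m) : a * x ∈ rankSpan k b r m := by
  induction hx using Submodule.span_induction with
  | mem x hx =>
    obtain ⟨j, hj, rfl⟩ := hx
    have h1 := rankSpan_mono b r (le_of_lt hj) (mul_basis_sub_mem hmul a j)
    have h2 : b j ∈ rankSpan k b r m := Submodule.subset_span ⟨j, hj, rfl⟩
    have := add_mem h1 (Submodule.smul_mem _ (diagCoeff b c j a) h2)
    rwa [sub_add_cancel] at this
  | zero => simp
  | add x y _ _ hx hy => rw [mul_add]; exact add_mem hx hy
  | smul t x _ hx => rw [mul_smul_comm]; exact Submodule.smul_mem _ t hx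

theorem diagCoeff_eq_zero_of_mem (hmul : ∀ i j, b i * b j - c i j • b j ∈ rankSpan k b r (r j))
    {a : A} {j : ι} (h : a * b j ∈ rankSpan k b r (r j)) : diagCoeff b c j a = 0 := by
  by_contra hne
  have h1 := sub_mem h (mul_basis_sub_mem hmul a j)
  rw [sub_sub_cancel] at h1
  have h2 := Submodule.smul_mem _ (diagCoeff b c j a)⁻¹ h1
  rw [inv_smul_smul₀ hne] at h2
  exact b.linearIndependent.notMem_span_image (by simp) h2

theorem mul_basis_mem (hmul : ∀ i j, b i * b j - c i j • b j ∈ rankSpan k b r (r j))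
    {a : A} {j : ι} (h : diagCoeff b c j a = 0) : a * b j ∈ rankSpan k b r (r j) := by
  simpa [h] using mul_basis_sub_mem hmul a j

/-- Left multiplication by `a` lowers the filtration by one step, so a power of `a` annihilates the
whole algebra, in particular 1. -/
theorem isNilpotent_of_diagCoeff_eq_zero [Finite ι]
    (hmul : ∀ i j, b i * b j - c i j • b j ∈ rankSpan k b r (r j))
    {a : A} (h : ∀ j, diagCoeff b c j a = 0) : IsNilpotent a := by
  have step : ∀ (m : ℕ) (x : A), x ∈ rankSpan k b r (m + 1) → a * x ∈ rankSpan k b r m := by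
    intro m x hx
    induction hx using Submodule.span_induction with
    | mem x hx =>
      obtain ⟨j, hj, rfl⟩ := hx
      exact rankSpan_mono b r (Nat.lt_succ_iff.1 hj) (mul_basis_mem hmul (h j))
    | zero => simp
    | add x y _ _ hx hy => rw [mul_add]; exact add_mem hx hy
    | smul t x _ hx => rw [mul_smul_comm]; exact Submodule.smul_mem _ t hx
  have pow : ∀ (m : ℕ) (x : A), x ∈ rankSpan k b r m → a ^ m * x = 0 := by
    intro m
    induction m with
    | zero =>
      intro x hx
      have : rankSpan k b r 0 = ⊥ := by simp [rankSpan]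
      rw [this, Submodule.mem_bot] at hx
      rw [hx, mul_zero]
    | succ m ih =>
      intro x hx
      rw [pow_succ, mul_assoc]
      exact ih _ (step m x hx)
  obtain ⟨M, hM⟩ := (Set.finite_range r).bddAbove
  refine ⟨M + 1, ?_⟩
  rw [← mul_one (a ^ (M + 1))]
  apply pow
  have : rankSpan k b r (M + 1) = ⊤ := by
    rw [rankSpan, ← b.span_eq, ← Set.image_univ]
    congr 2
    ext j
    simpa using Nat.lt_succ_of_le (hM ⟨j, rfl⟩)
  rw [this]
  exact Submodule.mem_top

/-- If the coefficient `t` at `j` is nonzero, then `1 - t⁻¹ a` sends `b j` to lower rank and has no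
left inverse, because left multiplication preserves the filtration. If all coefficients vanish, they
also vanish for every `y * a`, so `y * a` is nilpotent and `1 + y * a` is a unit. -/
theorem mem_jacobson_iff_diagCoeff [Finite ι]
    (hmul : ∀ i j, b i * b j - c i j • b j ∈ rankSpan k b r (r j)) (a : A) :
    a ∈ Ring.jacobson A ↔ ∀ j, diagCoeff b c j a = 0 := by
  rw [← Ideal.jacobson_bot, Ideal.mem_jacobson_iff]
  constructor
  · intro h j
    by_contra hne
    obtain ⟨z, hz⟩ := h (algebraMap k A (-(diagCoeff b c j a)⁻¹))
    rw [Ideal.mem_bot, sub_eq_zero] at hz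
    have h1 : (1 - (diagCoeff b c j a)⁻¹ • a) * b j ∈ rankSpan k b r (r j) := by
      have := Submodule.smul_mem _ (-(diagCoeff b c j a)⁻¹) (mul_basis_sub_mem hmul a j)
      rw [smul_sub, smul_smul, neg_mul, inv_mul_cancel₀ hne] at this
      convert this using 1
      rw [sub_mul, one_mul, smul_mul_assoc, neg_smul, neg_smul, one_smul]
      abel
    have h2 := mul_mem_rankSpan hmul z h1
    rw [← mul_assoc] at h2
    have h3 : z * (1 - (diagCoeff b c j a)⁻¹ • a) = 1 := by
      rw [mul_assoc, ← Algebra.smul_def, neg_smul, mul_neg] at hz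
      rw [mul_sub, mul_one, sub_eq_neg_add]
      exact hz
    rw [h3, one_mul] at h2
    exact b.linearIndependent.notMem_span_image (by simp) h2
  · intro h y
    have h1 : IsNilpotent (y * a) := by
      refine isNilpotent_of_diagCoeff_eq_zero hmul fun j => diagCoeff_eq_zero_of_mem hmul ?_
      rw [mul_assoc]
      exact mul_mem_rankSpan hmul y (mul_basis_mem hmul (h j))
    obtain ⟨u, hu⟩ := h1.isUnit_add_one
    refine ⟨(u⁻¹ : Aˣ), ?_⟩
    rw [Ideal.mem_bot, sub_eq_zero, ← Units.inv_mul u, hu, mul_add, mul_one, mul_assoc]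

/-- If left multiplication by basis elements is triangular, with diagonal coefficients that
separate the classes of an equivalence relation in a triangular way, then the radical is spanned
by the differences of equivalent basis elements. -/
theorem jacobson_eq_span_sub [Finite ι]
    (hmul : ∀ i j, b i * b j - c i j • b j ∈ rankSpan k b r (r j)) (s : Setoid ι)
    (hc : ∀ i i' j, s i i' → c i j = c i' j) (hdiag : ∀ i, c i i ≠ 0)
    (htri : ∀ i j, c i j ≠ 0 → r i ≤ r j → s i j) :
    (Ring.jacobson A).restrictScalars k =
      Submodule.span k {x | ∃ i i', s i i' ∧ x = b i - b i'} := by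
  classical
  have := Fintype.ofFinite ι
  set D := Submodule.span k {x | ∃ i i', s i i' ∧ x = b i - b i'} with hD
  have hle : ∀ x ∈ D, ∀ j, diagCoeff b c j x = 0 := by
    intro x hx j
    induction hx using Submodule.span_induction with
    | mem x hx =>
      obtain ⟨i, i', h, rfl⟩ := hx
      rw [map_sub, diagCoeff, b.constr_basis, b.constr_basis, hc i i' j h, sub_self]
    | zero => simp
    | add x y _ _ hx hy => rw [map_add, hx, hy, add_zero]
    | smul t x _ hx => rw [map_smul, hx, smul_zero]
  ext a
  rw [Submodule.restrictScalars_mem, mem_jacobson_iff_diagCoeff hmul]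
  refine ⟨fun h => ?_, hle a⟩
  let rep : ι → ι := fun i => (Quotient.mk s i).out
  have hrep : ∀ i, s i (rep i) := fun i => s.symm (Quotient.exact (Quotient.out_eq _))
  have hrep_eq : ∀ i i', s i i' → rep i = rep i' := fun i i' h =>
    congrArg Quotient.out (Quotient.sound h)
  -- Modulo `D` each basis element may be replaced by the representative of its class. It remains to
  -- show that the resulting class sums `C` are zero.
  let C : ι → k := fun t => ∑ i with rep i = t, b.repr a i
  have hay : a - ∑ i, b.repr a i • b (rep i) ∈ D := by
    have h1 : a - ∑ i, b.repr a i • b (rep i) = ∑ i, b.repr a i • (b i - b (rep i)) := by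
      simp only [smul_sub, Finset.sum_sub_distrib, b.sum_repr]
    rw [h1]
    refine Submodule.sum_mem _ fun i _ => ?_
    exact Submodule.smul_mem _ _ (Submodule.subset_span ⟨i, rep i, hrep i, rfl⟩)
  have hy : ∑ i, b.repr a i • b (rep i) = ∑ t, C t • b t := by
    rw [← Finset.sum_fiberwise Finset.univ rep]
    refine Finset.sum_congr rfl fun t _ => ?_
    rw [Finset.sum_smul]
    exact Finset.sum_congr rfl fun i hi => by rw [(Finset.mem_filter.1 hi).2]
  have hC : ∀ t, C t = 0 := by
    by_contra! hne
    obtain ⟨t₀, ht₀⟩ := hne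
    -- At a representative of largest rank, `htri` removes the contributions of all other
    -- representatives, so the diagonal coefficient there is `C t * c t t`, which cannot be zero.
    obtain ⟨t, ht, hmax⟩ := Finset.exists_max_image (Finset.univ.filter fun t => C t ≠ 0) r
      ⟨t₀, by simpa using ht₀⟩
    have htC := (Finset.mem_filter.1 ht).2
    have hCrep : ∀ t, C t ≠ 0 → rep t = t := by
      intro t ht
      obtain ⟨i, hi, -⟩ := Finset.exists_ne_zero_of_sum_ne_zero ht
      rw [← (Finset.mem_filter.1 hi).2]
      exact (hrep_eq _ _ (hrep i)).symm
    have h1 : diagCoeff b c t (∑ t, C t • b t) = 0 := by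
      have := hle _ hay t
      rw [map_sub, h, zero_sub, neg_eq_zero, hy] at this
      exact this
    rw [map_sum, Finset.sum_eq_single t] at h1
    · rw [map_smul, diagCoeff, b.constr_basis, smul_eq_mul] at h1
      exact (mul_ne_zero htC (hdiag t)) h1
    · intro t' _ hne
      rw [map_smul, diagCoeff, b.constr_basis, smul_eq_mul]
      by_contra hcon
      have hC' := left_ne_zero_of_mul hcon
      have h2 := htri t' t (right_ne_zero_of_mul hcon) (hmax t' (by simpa using hC'))
      apply hne
      rw [← hCrep t' hC', ← hCrep t htC, hrep_eq _ _ h2]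
    · intro h; exact absurd (Finset.mem_univ t) h
  rw [hy] at hay
  simpa [hC] using hay

end

/-! ### The sums of minimal coset representatives form a basis -/

section
variable {n : ℕ} [hn : n.AtLeastTwo]

/-- Perturbing `u` slightly by `-v` keeps it dominant, since this need only be checked at simple
roots. So a positive root vanishing on `u` is nonpositive on `v`, and it is nonnegative there by
dominance. -/
theorem zeroSet_subset_of_vecType {v u : SignedPoint n → ℤ} (hv : OddVec v) (hu : OddVec u)
    (hdv : Dominant v) (hdu : Dominant u) (h : vecType u ⊆ vecType v) : zeroSet u ⊆ zeroSet v := by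
  have hneg : OddVec fun p => -v p := fun p => by simp only [hv p]
  have key : Dominant (faceMul u fun p => -v p) := by
    refine dominant_of_simple (hu.faceMul hneg) fun i => ?_
    rcases (hdu _ _ (posPair_root i)).lt_or_eq with h1 | h1
    · exact (faceMul_lt_of_lt _ h1).le
    · refine (faceMul_eq_faceMul.2 ⟨h1, ?_⟩).le
      rw [h h1]
  have main : ∀ p q, PosPair p q → u p = u q → v p = v q := by
    intro p q hpq e
    refine le_antisymm (hdv p q hpq) ?_
    by_contra! hc
    have h1 : faceMul u (fun p => -v p) q < faceMul u (fun p => -v p) p :=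
      faceMul_lt_faceMul.2 (Or.inr ⟨e.symm, by linarith⟩)
    exact absurd (key p q hpq) h1.not_ge
  rw [zeroSet_subset_iff]
  intro p q hpq e
  rcases lt_trichotomy p q with h1 | h1 | h1
  · exact main p q ⟨h1, hpq⟩ e
  · rw [h1]
  · exact (main q p ⟨h1, ne_neg_symm hpq⟩ e.symm).symm

theorem zeroSet_eq_of_vecType {v u : SignedPoint n → ℤ} (hv : OddVec v) (hu : OddVec u)
    (hdv : Dominant v) (hdu : Dominant u) (h : vecType u = vecType v) : zeroSet u = zeroSet v :=
  subset_antisymm (zeroSet_subset_of_vecType hv hu hdv hdu h.subset)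
    (zeroSet_subset_of_vecType hu hv hdu hdv h.superset)

/-- A dominant vector that is fixed by the simple reflections in `J` and by no others. -/
noncomputable def typeVec (J : Set (Fin n)) : SignedPoint n → ℤ :=
  (DComp.exists_indexSet_eq Jᶜ).choose.vec

theorem oddVec_typeVec (J : Set (Fin n)) : OddVec (typeVec J) := DComp.oddVec_vec _

theorem dominant_typeVec (J : Set (Fin n)) : Dominant (typeVec J) := DComp.dominant_vec _

theorem vecType_typeVec (J : Set (Fin n)) : vecType (typeVec J) = J := by
  rw [typeVec, DComp.vecType_vec, (DComp.exists_indexSet_eq Jᶜ).choose_spec, compl_compl]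

theorem DComp.zeroSet_vec (κ : DComp n) : zeroSet κ.vec = zeroSet (typeVec κ.indexSetᶜ) :=
  zeroSet_eq_of_vecType (oddVec_typeVec _) κ.oddVec_vec (dominant_typeVec _) κ.dominant_vec
    (by rw [vecType_typeVec, κ.vecType_vec])

/-- The number of roots that vanish on the faces of type `J`. -/
noncomputable def typeRank (J : Set (Fin n)) : ℕ := (zeroSet (typeVec J)).card

/-- Every set of simple roots is the set of descents of a group element. -/
theorem exists_ascents_eq (K : Set (Fin n)) : ∃ w : DGroup n, ∀ i,
    pull (rho n) w (rootLo i) < pull (rho n) w (rootHi i) ↔ i ∈ K := by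
  have hneg : OddVec fun p => -rho n p := fun p => by simp only [oddVec_rho n p]
  -- The chamber obtained from the face of type `Kᶜ` and the chamber opposite to `C`: simple roots
  -- in `K` stay positive because they are positive on the face, and the others become negative.
  obtain ⟨g, hg⟩ := exists_strictDominant_pull_faceMul (oddVec_typeVec Kᶜ) hneg
    (fun p q h => rho_injective (neg_injective h))
  refine ⟨g⁻¹, fun i => ?_⟩
  have h1 : SameFace (pull (rho n) g⁻¹) (faceMul (typeVec Kᶜ) fun p => -rho n p) := by
    have := (StrictDominant.sameFace (v := rho n) (fun p q h => h.1) hg).pull g⁻¹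
    rwa [pull_pull, mul_inv_cancel, pull_one] at this
  rw [h1 _ _ (posPair_root i).2, faceMul_lt_faceMul]
  have h2 : i ∈ vecType (typeVec Kᶜ) ↔ i ∉ K := by rw [vecType_typeVec]; rfl
  have h3 := rho_lt_rho.2 (posPair_root i).1
  rcases (dominant_typeVec Kᶜ _ _ (posPair_root i)).lt_or_eq with h4 | h4
  · exact iff_of_true (Or.inl h4) (not_not.1 (mt h2.2 h4.ne))
  · refine iff_of_false ?_ (h2.1 h4)
    rintro (h5 | ⟨-, h5⟩)
    · exact h5.ne h4
    · linarith

variable (k : Type*) [Field k]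

/-- The sum of minimal coset representatives, for a set of indices of generators. -/
noncomputable def typeSum (J : Set (Fin n)) : MonoidAlgebra k (DGroup n) :=
  cosetSum k (genSet n) (gen n '' J)

theorem mem_minCosetReps_iff (J : Set (Fin n)) (w : DGroup n) :
    w ∈ minCosetReps (genSet n) (gen n '' J) ↔
      ∀ i ∈ J, pull (rho n) w (rootLo i) < pull (rho n) w (rootHi i) := by
  have := minCosetReps_iff (oddVec_typeVec J) (dominant_typeVec J) w
  rwa [vecType_typeVec] at this

open Classical in
theorem coeff_typeSum (J : Set (Fin n)) (w : DGroup n) : (typeSum k J).coeff w =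
    if w ∈ minCosetReps (genSet n) (gen n '' J) then 1 else 0 := by
  rw [typeSum, cosetSum, MonoidAlgebra.coeff_sum, Finsupp.finsetSum_apply]
  simp only [MonoidAlgebra.of_apply, MonoidAlgebra.coeff_single, Finsupp.single_apply]
  rw [Finset.sum_ite_eq']
  simp only [Set.Finite.mem_toFinset]

theorem typeSum_univ : typeSum k (Set.univ : Set (Fin n)) = 1 := by
  have h1 : minCosetReps (genSet n) (gen n '' Set.univ) = {1} := by
    ext w
    rw [mem_minCosetReps_iff, Set.mem_singleton_iff]
    constructor
    · intro h
      exact eq_one_of_strictDominant (strictDominant_of_simple ((oddVec_rho n).pull w)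
        fun i => h i trivial)
    · rintro rfl i -
      exact rho_lt_rho.2 (posPair_root i).1
  have h2 : (Set.toFinite (minCosetReps (genSet n) (gen n '' Set.univ))).toFinset = {1} := by
    ext w
    rw [Set.Finite.mem_toFinset, h1, Finset.mem_singleton, Set.mem_singleton_iff]
  rw [typeSum, cosetSum, h2, Finset.sum_singleton, map_one]

/-- The coefficient at an element with ascent set `K` yields `∑_{J ⊆ K} a J = 0`, a system that is
unitriangular for inclusion. -/
theorem linearIndependent_typeSum : LinearIndependent k (typeSum k (n := n)) := by
  classical
  have : Fintype (Set (Fin n)) := Fintype.ofFinite _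
  rw [Fintype.linearIndependent_iff]
  intro a ha
  have h1 : ∀ K : Set (Fin n), ∑ J with J ⊆ K, a J = 0 := by
    intro K
    obtain ⟨w, hw⟩ := exists_ascents_eq K
    have h2 := congrArg (fun x => x.coeff w) ha
    simp only [MonoidAlgebra.coeff_sum, Finsupp.finsetSum_apply, MonoidAlgebra.coeff_smul,
      Finsupp.smul_apply, coeff_typeSum, mem_minCosetReps_iff, hw, smul_eq_mul,
      mul_ite, mul_one, mul_zero,
      MonoidAlgebra.coeff_zero, Finsupp.zero_apply] at h2
    rw [Finset.sum_filter]
    convert h2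
    exact Iff.rfl
  intro K
  induction K using WellFoundedLT.induction with
  | _ K ih =>
    have h2 := h1 K
    rw [Finset.sum_eq_single K] at h2
    · exact h2
    · intro J hJ hne
      exact ih J (lt_of_le_of_ne (Finset.mem_filter.1 hJ).2 hne)
    · intro h
      simp at h

theorem orbitSum_typeVec (J : Set (Fin n)) :
    orbitSum k (typeVec J) = (Nat.card (stab (typeVec J)) : k) • typeSum k J := by
  rw [orbitSum_of_dominant k (oddVec_typeVec J) (dominant_typeVec J), vecType_typeVec, typeSum]

theorem orbitSum_mem_span {v : SignedPoint n → ℤ} (hv : OddVec v) :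
    ∃ J : Set (Fin n), typeRank J = (zeroSet v).card ∧
      orbitSum k v ∈ Submodule.span k {typeSum k J} := by
  obtain ⟨g, hg⟩ := exists_dominant_pull hv
  refine ⟨vecType (pull v g), ?_, ?_⟩
  · rw [typeRank, zeroSet_eq_of_vecType (hv.pull g) (oddVec_typeVec _) hg (dominant_typeVec _)
      (vecType_typeVec _), card_zeroSet_pull]
  · rw [← orbitSum_pull k v g, orbitSum_of_dominant k (hv.pull g) hg]
    exact Submodule.smul_mem _ _ (Submodule.mem_span_singleton_self _)

/-! ### Triangularity of multiplication in the descent algebra. -/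

open Classical in
/-- The number of translates of the face of type `K` that lie in the span of the face of
type `J`. -/
noncomputable def fixCount (K J : Set (Fin n)) : ℕ :=
  (Finset.univ.filter fun g : DGroup n => zeroSet (typeVec J) ⊆ zeroSet (pull (typeVec K) g)).card

/-- A translate of the `K`-face on which all roots vanishing on the `J`-face vanish leaves the
latter unchanged; any other translate leads to a face with fewer vanishing roots. -/
theorem orbitSum_mul_sub_mem (K J : Set (Fin n)) :
    orbitSum k (typeVec K) * orbitSum k (typeVec J) - (fixCount K J : k) • orbitSum k (typeVec J) ∈
      rankSpan k (typeSum k) typeRank (typeRank J) := by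
  classical
  rw [orbitSum_mul_orbitSum k (oddVec_typeVec K) (oddVec_typeVec J), fixCount,
    Nat.cast_smul_eq_nsmul, ← Finset.sum_const,
    ← Finset.sum_filter_add_sum_filter_not Finset.univ
      fun g : DGroup n => zeroSet (typeVec J) ⊆ zeroSet (pull (typeVec K) g)]
  have h1 : ∀ g ∈ Finset.univ.filter fun g : DGroup n =>
      zeroSet (typeVec J) ⊆ zeroSet (pull (typeVec K) g),
      orbitSum k (faceMul (typeVec J) (pull (typeVec K) g)) = orbitSum k (typeVec J) := by
    intro g hg
    exact orbitSum_congr k ((oddVec_typeVec J).faceMul ((oddVec_typeVec K).pull g))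
      (oddVec_typeVec J) (sameFace_faceMul_of_subset (Finset.mem_filter.1 hg).2)
  rw [Finset.sum_congr rfl h1, add_sub_cancel_left]
  refine Submodule.sum_mem _ fun g hg => ?_
  obtain ⟨L, hL, hmem⟩ :=
    orbitSum_mem_span k ((oddVec_typeVec J).faceMul ((oddVec_typeVec K).pull g))
  refine Submodule.span_mono ?_ hmem
  rw [Set.singleton_subset_iff]
  refine ⟨L, ?_, rfl⟩
  rw [Set.mem_ofPred_eq, hL]
  exact card_zeroSet_faceMul_lt (Finset.mem_filter.1 hg).2

theorem fixCount_congr {K K' : Set (Fin n)} (h : ZeroConj (typeVec K) (typeVec K'))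
    (J : Set (Fin n)) : fixCount K J = fixCount K' J := by
  classical
  obtain ⟨g, hg⟩ := h
  have hz : ∀ x, zeroSet (pull (typeVec K) x) = zeroSet (pull (typeVec K') (g * x)) := fun x => by
    rw [← pull_pull]
    exact subset_antisymm ((zeroSet_pull_subset_iff x).2 hg.subset)
      ((zeroSet_pull_subset_iff x).2 hg.superset)
  unfold fixCount
  rw [Finset.card_filter, Finset.card_filter, ← Equiv.sum_comp (Equiv.mulLeft g) fun x =>
    if zeroSet (typeVec J) ⊆ zeroSet (pull (typeVec K') x) then 1 else 0]
  exact Finset.sum_congr rfl fun x _ => if_congr (by rw [hz]; rfl) rfl rfl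

theorem card_stab_congr {K K' : Set (Fin n)} (h : ZeroConj (typeVec K) (typeVec K')) :
    Nat.card (stab (typeVec K)) = Nat.card (stab (typeVec K')) := by
  refine le_antisymm ?_ ?_
  · obtain ⟨g, hg⟩ := h
    exact card_stab_le (oddVec_typeVec K) (dominant_typeVec K) (oddVec_typeVec K') g hg.subset
  · obtain ⟨g, hg⟩ := h.symm
    exact card_stab_le (oddVec_typeVec K') (dominant_typeVec K') (oddVec_typeVec K) g hg.subset

theorem fixCount_self_ne_zero (J : Set (Fin n)) : fixCount J J ≠ 0 := by
  classical
  rw [fixCount, Finset.card_ne_zero]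
  exact ⟨1, by simp⟩

/-- A containment of zero sets whose larger member has no more elements than the smaller is an
equality. -/
theorem zeroConj_of_fixCount_ne_zero {K J : Set (Fin n)} (h : fixCount K J ≠ 0)
    (hr : typeRank K ≤ typeRank J) : ZeroConj (typeVec K) (typeVec J) := by
  classical
  rw [fixCount, Finset.card_ne_zero] at h
  obtain ⟨g, hg⟩ := h
  refine ZeroConj.symm ⟨g, Finset.eq_of_subset_of_card_le (Finset.mem_filter.1 hg).2 ?_⟩
  rwa [card_zeroSet_pull]

variable [CharZero k]

theorem card_stab_ne_zero (v : SignedPoint n → ℤ) : (Nat.card (stab v) : k) ≠ 0 := by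
  exact_mod_cast Nat.card_pos.ne'

theorem typeSum_eq (J : Set (Fin n)) :
    typeSum k J = (Nat.card (stab (typeVec J)) : k)⁻¹ • orbitSum k (typeVec J) := by
  rw [orbitSum_typeVec, inv_smul_smul₀ (card_stab_ne_zero k _)]

theorem typeSum_mul_sub_mem (K J : Set (Fin n)) :
    typeSum k K * typeSum k J -
        ((Nat.card (stab (typeVec K)) : k)⁻¹ * fixCount K J) • typeSum k J ∈
      rankSpan k (typeSum k) typeRank (typeRank J) := by
  have h := Submodule.smul_mem _ ((Nat.card (stab (typeVec K)) : k)⁻¹ *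
    (Nat.card (stab (typeVec J)) : k)⁻¹) (orbitSum_mul_sub_mem k K J)
  convert h using 1
  rw [typeSum_eq, typeSum_eq, smul_mul_smul_comm, smul_sub, smul_smul, smul_smul]
  congr 2
  ring

/-- Solomon's theorem: the sums of minimal coset representatives span the descent algebra. -/
theorem toSubmodule_descentAlgebra :
    Subalgebra.toSubmodule (SigmaD k n) = Submodule.span k (Set.range (typeSum k)) := by
  have hrank : ∀ m, rankSpan k (typeSum k (n := n)) typeRank m ≤
      Submodule.span k (Set.range (typeSum k)) := fun m =>
    Submodule.span_mono (Set.image_subset_range _ _)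
  have hone : (1 : MonoidAlgebra k (DGroup n)) ∈ Submodule.span k (Set.range (typeSum k)) :=
    typeSum_univ k (n := n) ▸ Submodule.subset_span ⟨_, rfl⟩
  have hmul : ∀ x y : MonoidAlgebra k (DGroup n), x ∈ Submodule.span k (Set.range (typeSum k)) →
      y ∈ Submodule.span k (Set.range (typeSum k)) →
      x * y ∈ Submodule.span k (Set.range (typeSum k)) := by
    intro x y hx hy
    have h1 := Submodule.mul_mem_mul hx hy
    rw [Submodule.span_mul_span] at h1
    refine Submodule.span_le.2 ?_ h1
    rintro _ ⟨_, ⟨K, rfl⟩, _, ⟨J, rfl⟩, rfl⟩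
    have h2 := add_mem (hrank _ (typeSum_mul_sub_mem k K J))
      (Submodule.smul_mem _ ((Nat.card (stab (typeVec K)) : k)⁻¹ * fixCount K J)
        (Submodule.subset_span ⟨J, rfl⟩))
    rwa [sub_add_cancel] at h2
  apply le_antisymm
  · have : SigmaD k n ≤ (Submodule.span k (Set.range (typeSum k))).toSubalgebra hone hmul := by
      refine Algebra.adjoin_le ?_
      rintro _ ⟨J, hJ, rfl⟩
      refine Submodule.subset_span ⟨gen n ⁻¹' J, ?_⟩
      rw [typeSum, Set.image_preimage_eq_of_subset hJ]
    exact this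
  · rw [Submodule.span_le]
    rintro _ ⟨J, rfl⟩
    exact Algebra.subset_adjoin ⟨gen n '' J, Set.image_subset_range _ _, rfl⟩

/-! ### The basis of the descent algebra, and labels as its indices. -/

/-- The sums of minimal coset representatives, as elements of the descent algebra. -/
noncomputable def typeElt (J : Set (Fin n)) : SigmaD k n :=
  descentElt k (genSet n) (gen n '' J) (Set.image_subset_range _ _)

theorem coe_typeElt (J : Set (Fin n)) :
    (typeElt k J : MonoidAlgebra k (DGroup n)) = typeSum k J := rfl

theorem val_comp_typeElt : (SigmaD k n).val.toLinearMap ∘ typeElt k = typeSum k := rfl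

theorem mem_span_of_coe_mem {s : Set (Set (Fin n))} {x : SigmaD k n}
    (h : (x : MonoidAlgebra k (DGroup n)) ∈ Submodule.span k (typeSum k '' s)) :
    x ∈ Submodule.span k (typeElt k '' s) := by
  rw [← val_comp_typeElt, Set.image_comp, ← Submodule.map_span] at h
  obtain ⟨y, hy, e⟩ := h
  rwa [← Subtype.ext e]

/-- The basis of the descent algebra. -/
noncomputable def typeBasis : Module.Basis (Set (Fin n)) k (SigmaD k n) :=
  Module.Basis.mk (v := typeElt k)
    (LinearIndependent.of_comp (SigmaD k n).val.toLinearMap (linearIndependent_typeSum k))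
    (by
      intro x _
      rw [← Set.image_univ]
      refine mem_span_of_coe_mem k ?_
      rw [Set.image_univ, ← toSubmodule_descentAlgebra]
      exact x.2)

theorem coe_typeBasis : ⇑(typeBasis k (n := n)) = typeElt k := Module.Basis.coe_mk _ _

theorem typeBasis_mul_sub_mem (K J : Set (Fin n)) :
    typeBasis k K * typeBasis k J -
        ((Nat.card (stab (typeVec K)) : k)⁻¹ * fixCount K J) • typeBasis k J ∈
      rankSpan k (typeBasis k) typeRank (typeRank J) := by
  rw [coe_typeBasis]
  refine mem_span_of_coe_mem k ?_
  rw [AddSubgroupClass.coe_sub, MulMemClass.coe_mul, Subalgebra.coe_smul, coe_typeElt, coe_typeElt]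
  exact typeSum_mul_sub_mem k K J

theorem basisB_eq (κ : DComp n) : basisB k κ = typeBasis k κ.indexSetᶜ := by
  rw [coe_typeBasis]
  apply Subtype.ext
  have h : genSet n \ κ.subsetOf = gen n '' κ.indexSetᶜ := by
    rw [genSet, DComp.subsetOf, ← Set.image_univ, ← Set.image_sdiff gen_injective,
      Set.compl_eq_univ_sdiff]
  rw [coe_typeElt, typeSum, ← h]
  rfl

/-- Two sets of simple reflections are related if their zero sets are conjugate. -/
def typeSetoid (n : ℕ) [n.AtLeastTwo] : Setoid (Set (Fin n)) where
  r K J := ZeroConj (typeVec K) (typeVec J)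
  iseqv := ⟨fun _ => ⟨1, rfl⟩, ZeroConj.symm, ZeroConj.trans⟩

theorem DComp.equivalent_iff (κ ν : DComp n) :
    κ.Equivalent ν ↔ typeSetoid n κ.indexSetᶜ ν.indexSetᶜ := by
  rw [← DComp.zeroConj_iff]
  have h : ∀ (κ : DComp n) (g : DGroup n),
      zeroSet (pull κ.vec g) = zeroSet (pull (typeVec κ.indexSetᶜ) g) := fun κ g =>
    subset_antisymm ((zeroSet_pull_subset_iff g).2 κ.zeroSet_vec.subset)
      ((zeroSet_pull_subset_iff g).2 κ.zeroSet_vec.superset)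
  refine exists_congr fun g => ?_
  rw [h ν g, κ.zeroSet_vec]

end

theorem mainTheorem2 (k : Type*) [Field k] [CharZero k] (n : ℕ) [n.AtLeastTwo] :
    (Ring.jacobson (SigmaD k n)).restrictScalars k =
      Submodule.span k
        {x : SigmaD k n | ∃ κ ν : DComp n, κ.Equivalent ν ∧ x = basisB k κ - basisB k ν} := by
  -- The coefficient is written as a function applied to `K` and `J` so that `jacobson_eq_span_sub`
  -- can read off its matrix `c`.
  have hmul : ∀ K J : Set (Fin n), typeBasis k K * typeBasis k J -
      (fun K J => (Nat.card (stab (typeVec K)) : k)⁻¹ * fixCount K J) K J • typeBasis k J ∈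
        rankSpan k (typeBasis k) typeRank (typeRank J) := typeBasis_mul_sub_mem k
  rw [jacobson_eq_span_sub hmul (typeSetoid n)]
  · congr 1
    ext x
    constructor
    · rintro ⟨K, J, h, rfl⟩
      obtain ⟨κ, hκ⟩ := DComp.exists_indexSet_eq Kᶜ
      obtain ⟨ν, hν⟩ := DComp.exists_indexSet_eq Jᶜ
      replace hκ : K = κ.indexSetᶜ := by rw [hκ, compl_compl]
      replace hν : J = ν.indexSetᶜ := by rw [hν, compl_compl]
      refine ⟨κ, ν, ?_, ?_⟩
      · rw [DComp.equivalent_iff, ← hκ, ← hν]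
        exact h
      · rw [basisB_eq, basisB_eq, ← hκ, ← hν]
    · rintro ⟨κ, ν, h, rfl⟩
      exact ⟨_, _, (DComp.equivalent_iff κ ν).1 h, by rw [basisB_eq, basisB_eq]⟩
  · intro K K' J h
    rw [card_stab_congr h, fixCount_congr h]
  · intro J
    exact mul_ne_zero (inv_ne_zero (card_stab_ne_zero k _))
      (Nat.cast_ne_zero.2 (fixCount_self_ne_zero J))
  · intro K J h hr
    exact zeroConj_of_fixCount_ne_zero (Nat.cast_ne_zero.1 (right_ne_zero_of_mul h)) hr
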